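/- Setting. Let $K\ge 1$ and let $\theta=(\theta_1,\dots,\theta_K)'\sim\mathcal N(\mu^0,V^0)$ with $V^0$ positive definite. There are $K$ sources; an observation of source $k$ is $X_k=\langle c_k,\theta\rangle+\epsilon_k$ with $\epsilon_k\sim\mathcal N(0,\sigma_k^2)$, $\sigma_k>0$, where the matrix $C$ with rows $c_k'$ is invertible and all error terms are independent of each other (across realizations and sources) and of $\theta$. In each period $t=1,2,\dots$ a decision maker (DM) chooses $B$ sources (repetition allowed), as a measurable function of the signal realizations of the earlier periods (an information acquisition strategy), observes the realizations, and then takes an action $a_t\in A_t$, as a measurable function of all realizations observed so far (a decision strategy). The payoff is $U(a_1,a_2,\dots;\theta_1)$, where the measurable spaces $A_t$ and the measurable real-valued function $U$ are arbitrary. Let $f(q_1,\dots,q_K)$ be the posterior variance of $\theta_1$ after $q_k$ observations of each source $k$. An acquisition strategy is myopic if at every history the $B$ sources it chooses, combined with the past observations, give the lowest posterior variance of $\theta_1$. A vector $n(t)=(n_1(t),\dots,n_K(t))$ is $t$-optimal if it minimizes $f$ over all vectors of nonnegative integers with sum $t$. Put $\tilde\theta_k=\frac1{\sigma_k}\langle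 c_k,\theta\rangle$, let $\tilde V$ be the covariance matrix of $(\tilde\theta_1,\dots,\tilde\theta_K)$, and let $R$ be the Euclidean operator norm of $\tilde V^{-1}$. Proposition. Suppose that $\theta_1=\tilde\theta_1+\dots+\tilde\theta_K$, i.e. all payoff weights on the transformed states are $1$. (a) If $B\ge 8(R+1)K^{1.5}$, then myopic information acquisition is optimal: there is a myopic acquisition strategy $S^*$ such that, for every choice of the action sets $A_t$ and the payoff function $U$, and for every acquisition strategy $S$ and decision strategy $A$ with finite expected payoff, there is a decision strategy $A^*$ such that the expected payoff of $(S^*,A^*)$ is finite and at least that of $(S,A)$. In particular, whenever the DM has an optimal strategy (among strategies with finite expected payoff), he has one that acquires information by $S^*$, hence myopically. (b) For every $t\ge 8(R+1)K\sqrt K$, every $t$-optimal vector $n(t)$ and every $i$, $$\left|n_i(t)-\frac tK\right|\le 4(R+1)\sqrt K .$$ -/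

import Mathlib

open MeasureTheory ProbabilityTheory
open scoped BigOperators

universe u

noncomputable section

namespace Acquisition

/-- An informational environment with `K` states and `K` sources.  The state vector is Gaussian with
mean `mean` and positive definite covariance matrix `V`; source `k` has coefficient vector `C k`
(the `k`-th row of an invertible matrix) and noise standard deviation `σ k > 0`.
The payoff-relevant state is the coordinate `0`. -/
structure Environment (K : ℕ) where
  mean : EuclideanSpace ℝ (Fin K)
  V : Matrix (Fin K) (Fin K) ℝ
  C : Matrix (Fin K) (Fin K) ℝ
  σ : Fin K → ℝ
  V_posDef : V.PosDef
  C_invertible : IsUnit C.det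
  σ_pos : ∀ k, 0 < σ k

/-- A sample point: the state vector, and for each pair `(n, k)` the (standardized) noise in the
`n`-th potential realization of source `k`. -/
abbrev Sample (K : ℕ) : Type := EuclideanSpace ℝ (Fin K) × (ℕ × Fin K → ℝ)

/-- `History B t`: the realizations observed in the first `t` periods, `B` per period. -/
abbrev History (B t : ℕ) : Type := Fin t → Fin B → ℝ

/-- An information acquisition strategy: at each period, a measurable map from the past signal
realizations to the `B` sources observed in that period, repetition allowed.  A multi-set of `B`
sources is given by a listing of it. -/
structure InfoStrategy (K B : ℕ) where
  choose : (t : ℕ) → History B t → (Fin B → Fin K)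
  measurable_choose : ∀ t, Measurable (choose t)

/-- Number of times each source occurs in a choice of `B` sources. -/
def tally {K B : ℕ} (c : Fin B → Fin K) (k : Fin K) : ℕ :=
  (Finset.univ.filter fun b => c b = k).card

/-- The division vector after the history `h` under `S`: how often each source was observed. -/
def InfoStrategy.division {K B : ℕ} (S : InfoStrategy K B) {t : ℕ} (h : History B t) : Fin K → ℕ :=
  ∑ s : Fin t, tally (S.choose s fun r : Fin s => h (Fin.castLE s.isLt.le r))

/-- A decision problem: action sets `Act t` for the periods `t = 0, 1, …`, and a payoff that is an
arbitrary (measurable) function of the whole action sequence and the payoff-relevant state. -/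
structure DecisionProblem where
  Act : ℕ → Type u
  measAct : ∀ t, MeasurableSpace (Act t)
  U : ((t : ℕ) → Act t) → ℝ → ℝ
  measurable_U : Measurable fun p : ((t : ℕ) → Act t) × ℝ => U p.1 p.2

attribute [instance] DecisionProblem.measAct

/-- A decision strategy: the action of each period as a measurable function of the realizations
observed up to and including that period. -/
structure DecisionStrategy (D : DecisionProblem.{u}) (B : ℕ) where
  act : (t : ℕ) → History B (t + 1) → D.Act t
  measurable_act : ∀ t, Measurable (act t)

namespace Environment

variable {K : ℕ}

/-- The probability measure on sample points: the states have law `N(mean, V)`, all noise terms are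
standard normal, and everything is independent. -/
def P (E : Environment K) : Measure (Sample K) :=
  (multivariateGaussian E.mean E.V).prod (Measure.infinitePi fun _ : ℕ × Fin K => gaussianReal 0 1)

/-- The `n`-th realization of source `k`: `⟨c_k, θ⟩` plus noise with variance `σ_k ^ 2`. -/
def signal (E : Environment K) (n : ℕ) (k : Fin K) (ω : Sample K) : ℝ :=
  (∑ j, E.C k j * ω.1 j) + E.σ k * ω.2 (n, k)

/-- The transformed state `⟨c_k, θ⟩ / σ_k`. -/
def transformedState (E : Environment K) (k : Fin K) (θ : EuclideanSpace ℝ (Fin K)) : ℝ :=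
  (1 / E.σ k) * ∑ j, E.C k j * θ j

/-- The prior covariance matrix of the transformed states. -/
def transformedCov (E : Environment K) : Matrix (Fin K) (Fin K) ℝ :=
  Matrix.of fun i j =>
    cov[E.transformedState i, E.transformedState j; multivariateGaussian E.mean E.V]

/-- The Euclidean operator norm of the inverse of the prior covariance of the transformed states. -/
def R (E : Environment K) : ℝ :=
  ‖Matrix.toEuclideanCLM (n := Fin K) (𝕜 := ℝ) (E.transformedCov)⁻¹‖

/-- The information contained in `q k` realizations of each source `k`. -/
abbrev observed (E : Environment K) (q : Fin K → ℕ) : MeasurableSpace (Sample K) :=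
  MeasurableSpace.comap
    (fun (ω : Sample K) (p : (k : Fin K) × Fin (q k)) => E.signal p.2 p.1 ω) inferInstance

/-- The posterior variance of the payoff-relevant state after `q k` observations of each source `k`.
In this Gaussian model the conditional variance is almost surely constant, so that its
expectation is its value. -/
def postVar [NeZero K] (E : Environment K) (q : Fin K → ℕ) : ℝ :=
  ∫ ω, (Var[fun ω' : Sample K => ω'.1 0; E.P | E.observed q]) ω ∂E.P

/-- `n` is a `t`-optimal division vector: it minimizes the posterior variance of the payoff-relevant
state among all allocations of `t` observations to the sources. -/
def IsOptimalDivision [NeZero K] (E : Environment K) (t : ℕ) (n : Fin K → ℕ) : Prop :=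
  ∑ k, n k = t ∧ ∀ q : Fin K → ℕ, ∑ k, q k = t → E.postVar n ≤ E.postVar q

/-- The myopic property: at every history the `B` chosen sources, combined with the past
observations, lead to the lowest posterior variance of the payoff-relevant state. -/
def IsMyopic [NeZero K] (E : Environment K) {B : ℕ} (S : InfoStrategy K B) : Prop :=
  ∀ (t : ℕ) (h : History B t) (c : Fin B → Fin K),
    E.postVar (S.division h + tally (S.choose t h)) ≤ E.postVar (S.division h + tally c)

/-- The history of the first `t` periods that arises at the sample point `ω` under `S`.  Slot `b` of
period `t` shows realization number `t * B + b` of the source chosen there, so that no two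
observations share a noise term. -/
def hist (E : Environment K) {B : ℕ} (S : InfoStrategy K B) (ω : Sample K) :
    (t : ℕ) → History B t
  | 0 => Fin.elim0
  | t + 1 => Fin.snoc (α := fun _ => Fin B → ℝ) (E.hist S ω t) fun b =>
      E.signal (t * B + b) (S.choose t (E.hist S ω t) b) ω

/-- The realized payoff. -/
def payoff [NeZero K] (E : Environment K) {B : ℕ} (D : DecisionProblem.{u})
    (S : InfoStrategy K B) (A : DecisionStrategy D B) (ω : Sample K) : ℝ :=
  D.U (fun t => A.act t (E.hist S ω (t + 1))) (ω.1 0)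

/-- The strategy `(S, A)` has a finite expected payoff. -/
def FinitePayoff [NeZero K] (E : Environment K) {B : ℕ} (D : DecisionProblem.{u})
    (S : InfoStrategy K B) (A : DecisionStrategy D B) : Prop :=
  Integrable (E.payoff D S A) E.P

/-- The expected payoff of `(S, A)`. -/
def expectedPayoff [NeZero K] (E : Environment K) {B : ℕ} (D : DecisionProblem.{u})
    (S : InfoStrategy K B) (A : DecisionStrategy D B) : ℝ :=
  ∫ ω, E.payoff D S A ω ∂E.P

/-- `(S, A)` is optimal among all strategies with finite expected payoff. -/
def IsOptimal [NeZero K] (E : Environment K) {B : ℕ} (D : DecisionProblem.{u})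
    (S : InfoStrategy K B) (A : DecisionStrategy D B) : Prop :=
  E.FinitePayoff D S A ∧ ∀ (S' : InfoStrategy K B) (A' : DecisionStrategy D B),
    E.FinitePayoff D S' A' → E.expectedPayoff D S' A' ≤ E.expectedPayoff D S A

/-- Immediate optimality of myopic acquisition with `B` observations per period.  There is a myopic
acquisition strategy such that in every decision problem each strategy is matched or improved by
one that acquires information by it; in particular, when the problem has an optimal strategy at all,
it has an optimal one that acquires information myopically. -/
def MyopicIsOptimal [NeZero K] (E : Environment K) (B : ℕ) : Prop :=
  ∃ S : InfoStrategy K B, E.IsMyopic S ∧ ∀ D : DecisionProblem.{u},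
    (∀ (S' : InfoStrategy K B) (A' : DecisionStrategy D B), E.FinitePayoff D S' A' →
      ∃ A : DecisionStrategy D B, E.FinitePayoff D S A ∧
        E.expectedPayoff D S' A' ≤ E.expectedPayoff D S A) ∧
    ((∃ (S' : InfoStrategy K B) (A' : DecisionStrategy D B), E.IsOptimal D S' A') →
      ∃ A : DecisionStrategy D B, E.IsOptimal D S A)

end Environment

end Acquisition

end

/-!
Let `A` be the prior precision matrix of the transformed states. The posterior variance of their sum
after `q k` observations of each source `k` is `1ᵀ (A + diag q)⁻¹ 1`. If the real-valued division
`q̄` gives `A + diag q̄` the constant row sum `c`, then this variance at `q = q̄ + δ` equals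
`K / c + δᵀ (A + diag q)⁻¹ δ / c ^ 2`. Rounding `q̄` makes the quadratic form small, so it is small
at a minimizer as well, and Cauchy–Schwarz bounds the entries of `δ`. When `B` is large compared
with this bound, optimal divisions of `0, B, 2 B, …` increase in every entry, hence a deterministic
strategy passes through all of them. It is myopic, and its posterior variance never exceeds that of
any other strategy.

Such a strategy dominates by a dynamic form of Blackwell's comparison. Given the history of another
strategy, the state is normal with a known variance, so noise added to the posterior mean makes it
as informative as the mean of the deterministic strategy. The latter therefore permits simulating
the other history, jointly with the state, by drawing each signal from its conditional law given
the simulated past and the current mean. Some realization of the randomization does at least as well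
as the other strategy.
-/

noncomputable section

namespace Acquisition

open Matrix
open scoped ENNReal

section QuadraticForm

variable {ι : Type*} [Fintype ι] [DecidableEq ι] {A P : Matrix ι ι ℝ}

lemma mulVec_inv_mulVec {R : Type*} [CommRing R] {P : Matrix ι ι R} (hP : IsUnit P) (x : ι → R) :
    P *ᵥ (P⁻¹ *ᵥ x) = x := by
  rw [mulVec_mulVec, mul_nonsing_inv _ ((isUnit_iff_isUnit_det P).1 hP), one_mulVec]

lemma dotProduct_mulVec_comm {ι R : Type*} [Fintype ι] [CommRing R] {P : Matrix ι ι R}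
    (hP : P.IsSymm) (x y : ι → R) : x ⬝ᵥ P *ᵥ y = y ⬝ᵥ P *ᵥ x := by
  rw [dotProduct_mulVec, ← mulVec_transpose, hP.eq, dotProduct_comm]

lemma one_dotProduct_inv_mulVec_one {𝕜 : Type*} [Field 𝕜] {P : Matrix ι ι 𝕜} (hP : IsUnit P)
    (hsymm : P.IsSymm) {c : 𝕜} (hc : c ≠ 0) {δ : ι → 𝕜} (h : P *ᵥ 1 = c • 1 + δ)
    (hδ : ∑ k, δ k = 0) :
    1 ⬝ᵥ P⁻¹ *ᵥ 1 = Fintype.card ι / c + (δ ⬝ᵥ P⁻¹ *ᵥ δ) / c ^ 2 := by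
  have hdet := (isUnit_iff_isUnit_det P).1 hP
  have hinv : (P⁻¹).IsSymm := hsymm.inv
  have hone : (1 : ι → 𝕜) = c • P⁻¹ *ᵥ 1 + P⁻¹ *ᵥ δ := by
    rw [← mulVec_smul, ← mulVec_add, ← h, mulVec_mulVec, nonsing_inv_mul _ hdet, one_mulVec]
  have hcard : (Fintype.card ι : 𝕜) = c * (1 ⬝ᵥ P⁻¹ *ᵥ 1) + 1 ⬝ᵥ P⁻¹ *ᵥ δ := by
    rw [← smul_eq_mul, ← dotProduct_smul, ← dotProduct_add, ← hone]
    simp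
  have hzero : 0 = c * (1 ⬝ᵥ P⁻¹ *ᵥ δ) + δ ⬝ᵥ P⁻¹ *ᵥ δ := by
    rw [dotProduct_mulVec_comm hinv 1 δ, ← smul_eq_mul, ← dotProduct_smul, ← dotProduct_add,
      ← hone, dotProduct_one, hδ]
  field_simp
  linear_combination c * -hcard + hzero

lemma dotProduct_inv_add_diagonal_mulVec_le (hA : A.PosSemidef) {d : ι → ℝ} (hd : ∀ k, 0 < d k)
    (δ : ι → ℝ) : δ ⬝ᵥ (A + diagonal d)⁻¹ *ᵥ δ ≤ ∑ k, δ k ^ 2 / d k := by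
  have hP : IsUnit (A + diagonal d) := (PosDef.posSemidef_add hA (PosDef.diagonal hd)).isUnit
  set u := (A + diagonal d)⁻¹ *ᵥ δ
  have hδu : δ ⬝ᵥ u = u ⬝ᵥ A *ᵥ u + ∑ k, d k * u k ^ 2 := by
    nth_rw 1 [← mulVec_inv_mulVec hP δ]
    rw [dotProduct_comm, add_mulVec, dotProduct_add]
    congr 1
    simp only [dotProduct, mulVec_diagonal]
    exact Finset.sum_congr rfl fun k _ => by ring
  have hAu : 0 ≤ u ⬝ᵥ A *ᵥ u := by simpa using hA.dotProduct_mulVec_nonneg u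
  have hsquares : 2 * (δ ⬝ᵥ u) ≤ ∑ k, δ k ^ 2 / d k + ∑ k, d k * u k ^ 2 := by
    rw [dotProduct, Finset.mul_sum, ← Finset.sum_add_distrib]
    refine Finset.sum_le_sum fun k _ => sub_nonneg.1 ?_
    have hsq : δ k ^ 2 / d k + d k * u k ^ 2 - 2 * (δ k * u k) = (δ k - d k * u k) ^ 2 / d k := by
      field_simp [(hd k).ne']
      ring
    exact hsq ▸ div_nonneg (sq_nonneg _) (hd k).le
  linarith

lemma sq_dotProduct_le (hP : P.PosDef) (x δ : ι → ℝ) :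
    (x ⬝ᵥ δ) ^ 2 ≤ (x ⬝ᵥ P *ᵥ x) * (δ ⬝ᵥ P⁻¹ *ᵥ δ) := by
  set u := P⁻¹ *ᵥ δ
  have hu : P *ᵥ u = δ := mulVec_inv_mulVec hP.isUnit δ
  have hux : u ⬝ᵥ P *ᵥ x = x ⬝ᵥ δ := by
    rw [dotProduct_mulVec_comm (isHermitian_iff_isSymm.1 hP.isHermitian), hu]
  have hdisc := discrim_le_zero (a := x ⬝ᵥ P *ᵥ x) (b := -2 * (x ⬝ᵥ δ)) (c := δ ⬝ᵥ u) fun r => by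
    have hnonneg : 0 ≤ (u - r • x) ⬝ᵥ P *ᵥ (u - r • x) :=
      hP.posSemidef.dotProduct_mulVec_nonneg (u - r • x)
    rw [mulVec_sub, mulVec_smul, hu, sub_dotProduct, dotProduct_sub, dotProduct_sub] at hnonneg
    simp only [smul_dotProduct, dotProduct_smul, smul_eq_mul, hux, dotProduct_comm u δ] at hnonneg
    linarith
  rw [discrim] at hdisc
  linarith

end QuadraticForm

section OperatorNorm

variable {ι : Type*} [Fintype ι] [DecidableEq ι] (A : Matrix ι ι ℝ)

lemma abs_dotProduct_mulVec_le (x y : ι → ℝ) :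
    |x ⬝ᵥ A *ᵥ y| ≤ ‖toEuclideanCLM (𝕜 := ℝ) A‖ * (√(x ⬝ᵥ x) * √(y ⬝ᵥ y)) := by
  have hnorm (z : ι → ℝ) : ‖WithLp.toLp 2 z‖ = √(z ⬝ᵥ z) := by
    simp [EuclideanSpace.norm_eq, dotProduct, sq]
  have hinner : x ⬝ᵥ A *ᵥ y =
      inner ℝ (WithLp.toLp 2 x) (toEuclideanCLM (𝕜 := ℝ) A (WithLp.toLp 2 y)) := by
    simp [toEuclideanCLM_toLp, EuclideanSpace.inner_toLp_toLp, dotProduct_comm]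
  rw [hinner, ← hnorm, ← hnorm, mul_left_comm]
  exact (abs_real_inner_le_norm _ _).trans
    (mul_le_mul_of_nonneg_left (ContinuousLinearMap.le_opNorm _ _) (norm_nonneg _))

lemma abs_mulVec_one_le (i : ι) :
    |(A *ᵥ 1) i| ≤ ‖toEuclideanCLM (𝕜 := ℝ) A‖ * √(Fintype.card ι) := by
  simpa using abs_dotProduct_mulVec_le A (Pi.single i 1) 1

lemma abs_apply_self_le (i : ι) : |A i i| ≤ ‖toEuclideanCLM (𝕜 := ℝ) A‖ := by
  simpa using abs_dotProduct_mulVec_le A (Pi.single i 1) (Pi.single i 1)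

lemma abs_sum_mulVec_one_le :
    |∑ i, (A *ᵥ 1) i| ≤ ‖toEuclideanCLM (𝕜 := ℝ) A‖ * Fintype.card ι := by
  simpa [one_dotProduct] using abs_dotProduct_mulVec_le A 1 1

end OperatorNorm

lemma exists_nat_abs_sub_le_one {ι : Type*} [Fintype ι] (x : ι → ℝ) (hx : ∀ k, 0 ≤ x k) (t : ℕ)
    (ht : ∑ k, x k = t) : ∃ m : ι → ℕ, ∑ k, m k = t ∧ ∀ k, |(m k : ℝ) - x k| ≤ 1 := by
  classical
  have hfloor : ∑ k, ⌊x k⌋₊ ≤ t := by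
    have : ∑ k, (⌊x k⌋₊ : ℝ) ≤ t := ht ▸ Finset.sum_le_sum fun k _ => Nat.floor_le (hx k)
    exact_mod_cast this
  have hceil : t ≤ ∑ k, ⌊x k⌋₊ + Fintype.card ι := by
    have : (t : ℝ) ≤ ∑ k, ((⌊x k⌋₊ : ℝ) + 1) :=
      ht ▸ Finset.sum_le_sum fun k _ => (Nat.lt_floor_add_one _).le
    rw [Finset.sum_add_distrib] at this
    simp only [Finset.sum_const, Finset.card_univ, nsmul_eq_mul, mul_one] at this
    exact_mod_cast this
  obtain ⟨s, -, hs⟩ := Finset.exists_subset_card_eq (s := (Finset.univ : Finset ι))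
    (n := t - ∑ k, ⌊x k⌋₊) (by rw [Finset.card_univ]; omega)
  refine ⟨fun k => ⌊x k⌋₊ + if k ∈ s then 1 else 0, ?_, fun k => ?_⟩
  · simp only [Finset.sum_add_distrib, Finset.sum_ite_mem, Finset.univ_inter, Finset.sum_const, hs,
      smul_eq_mul, mul_one]
    omega
  · have hle := Nat.floor_le (hx k)
    have hlt := (Nat.lt_floor_add_one (x k)).le
    rw [abs_le]
    dsimp only
    split_ifs <;> push_cast <;> constructor <;> linarith

section Precision

variable {ι : Type*} [DecidableEq ι] {A : Matrix ι ι ℝ}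

/-- The posterior precision matrix after `q k` unit-noise observations of each state `k`, for the
prior precision matrix `A`. -/
def precision (A : Matrix ι ι ℝ) (q : ι → ℕ) : Matrix ι ι ℝ :=
  A + diagonal fun k => (q k : ℝ)

lemma precision_posDef (hA : A.PosDef) (q : ι → ℕ) : (precision A q).PosDef :=
  hA.add_posSemidef (PosSemidef.diagonal fun k => Nat.cast_nonneg (q k))

variable [Fintype ι]

/-- The posterior covariances of the states with their sum. -/
def precWeight (A : Matrix ι ι ℝ) (q : ι → ℕ) : ι → ℝ :=
  (precision A q)⁻¹ *ᵥ 1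

/-- The posterior variance of the sum of the states. -/
def precVar (A : Matrix ι ι ℝ) (q : ι → ℕ) : ℝ :=
  ∑ k, precWeight A q k

lemma precision_mulVec_apply (q : ι → ℕ) (x : ι → ℝ) (k : ι) :
    (precision A q *ᵥ x) k = (A *ᵥ x) k + q k * x k := by
  simp [precision, add_mulVec, mulVec_diagonal]

lemma precision_mulVec_precWeight (hA : A.PosDef) (q : ι → ℕ) :
    precision A q *ᵥ precWeight A q = 1 :=
  mulVec_inv_mulVec (precision_posDef hA q).isUnit 1

lemma precVar_nonneg (hA : A.PosDef) (q : ι → ℕ) : 0 ≤ precVar A q := by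
  simpa [precVar, precWeight, dotProduct] using
    (precision_posDef hA q).inv.posSemidef.dotProduct_mulVec_nonneg 1

lemma precVar_antitone (hA : A.PosDef) : Antitone (precVar A) := fun q q' hq => by
  set x := precWeight A q'
  have hx : x ⬝ᵥ precision A q *ᵥ x ≤ x ⬝ᵥ precision A q' *ᵥ x := by
    refine Finset.sum_le_sum fun k _ => ?_
    rw [precision_mulVec_apply, precision_mulVec_apply]
    have hqk : (q k : ℝ) ≤ q' k := by exact_mod_cast hq k
    nlinarith [mul_le_mul_of_nonneg_right hqk (mul_self_nonneg (x k))]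
  have hsq := sq_dotProduct_le (precision_posDef hA q) x 1
  rw [precision_mulVec_precWeight hA, dotProduct_one] at hx
  rw [dotProduct_one, one_dotProduct] at hsq
  change precVar A q' ^ 2 ≤ _ * precVar A q at hsq
  have hle : precVar A q' ^ 2 ≤ precVar A q' * precVar A q :=
    hsq.trans (mul_le_mul_of_nonneg_right hx (precVar_nonneg hA q))
  nlinarith [precVar_nonneg hA q, precVar_nonneg hA q']

end Precision

section Division

lemma le_two_mul_of_quadratic {s R T x : ℝ} (hs : 1 ≤ s) (hR : 0 ≤ R)
    (hT : 8 * (R + 1) * s ≤ T) (hx : 0 ≤ x)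
    (hq : 7 * T * x ^ 2 ≤ 8 * (T + 3 * (R * s) + x) * (s * s)) : x ≤ 2 * s := by
  by_contra! hlt
  have hRs : 0 ≤ R * s := by positivity
  have hcoeff : 8 * (T + 3 * (R * s) + x) * (s * s) ≤ (11 * T + 8 * x) * (s * s) :=
    mul_le_mul_of_nonneg_right (by linarith) (mul_self_nonneg s)
  have hxs : 0 ≤ (T - 8 * s) * (x * s) := mul_nonneg (by linarith) (mul_nonneg hx (by linarith))
  have hquad : 7 * x ^ 2 ≤ 11 * (s * s) + x * s :=
    le_of_mul_le_mul_left (a := T) (by linarith) (by linarith)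
  have hfactor : 0 < (x - 2 * s) * (7 * x + 13 * s) := mul_pos (by linarith) (by linarith)
  nlinarith

variable {ι : Type*} [Fintype ι] {A : Matrix ι ι ℝ}

/-- The common row sum of the precision matrix at the balanced division of `t` observations. -/
def balancedLevel (A : Matrix ι ι ℝ) (t : ℕ) : ℝ :=
  (t + ∑ k, (A *ᵥ 1) k) / Fintype.card ι

/-- The real-valued division of `t` observations at which the precision matrix has equal row sums,
so that the posterior covariances of the states with their sum are equal. -/
def balancedDivision (A : Matrix ι ι ℝ) (t : ℕ) (k : ι) : ℝ :=
  balancedLevel A t - (A *ᵥ 1) k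

lemma sum_balancedDivision [Nonempty ι] (A : Matrix ι ι ℝ) (t : ℕ) :
    ∑ k, balancedDivision A t k = t := by
  simp only [balancedDivision, balancedLevel, Finset.sum_sub_distrib, Finset.sum_const,
    Finset.card_univ, nsmul_eq_mul]
  field_simp
  ring

lemma div_card_le_balancedLevel (hA : A.PosSemidef) (t : ℕ) :
    (t : ℝ) / Fintype.card ι ≤ balancedLevel A t := by
  have hsum : 0 ≤ ∑ k, (A *ᵥ 1) k := by
    simpa [one_dotProduct] using hA.dotProduct_mulVec_nonneg (1 : ι → ℝ)
  exact div_le_div_of_nonneg_right (by linarith) (Nat.cast_nonneg _)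

variable [DecidableEq ι]

lemma balancedLevel_le [Nonempty ι] (A : Matrix ι ι ℝ) (t : ℕ) :
    balancedLevel A t ≤ t / Fintype.card ι + ‖toEuclideanCLM (𝕜 := ℝ) A‖ := by
  rw [balancedLevel, add_div]
  have hcard : (0 : ℝ) < Fintype.card ι := Nat.cast_pos.2 Fintype.card_pos
  gcongr
  exact (div_le_iff₀ hcard).2 ((le_abs_self _).trans (abs_sum_mulVec_one_le A))

lemma precVar_eq_add [Nonempty ι] (hA : A.PosDef) {t : ℕ} (ht : balancedLevel A t ≠ 0) {q : ι → ℕ}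
    (hq : ∑ k, q k = t) {δ : ι → ℝ} (hδ : ∀ k, δ k = q k - balancedDivision A t k) :
    precVar A q = Fintype.card ι / balancedLevel A t +
      (δ ⬝ᵥ (precision A q)⁻¹ *ᵥ δ) / balancedLevel A t ^ 2 := by
  have hP := precision_posDef hA q
  rw [precVar, ← one_dotProduct, precWeight]
  refine one_dotProduct_inv_mulVec_one hP.isUnit (isHermitian_iff_isSymm.1 hP.isHermitian) ht ?_ ?_
  · ext k
    simp only [precision_mulVec_apply, Pi.add_apply, Pi.smul_apply, Pi.one_apply, smul_eq_mul, hδ,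
      balancedDivision]
    ring
  · simp only [hδ, Finset.sum_sub_distrib, sum_balancedDivision, ← hq, Nat.cast_sum, sub_self]

variable {t : ℕ} {n : ι → ℕ}

/-- Compares `n` with the rounded balanced division `m`, whose form is at most `∑ k, 1 / m k`
with `m k ≥ 7 / 8 * (t / card ι)`. -/
lemma dotProduct_inv_mulVec_le_of_isMin [Nonempty ι] (hA : A.PosDef) (hn : ∑ k, n k = t)
    (hmin : ∀ q : ι → ℕ, ∑ k, q k = t → precVar A n ≤ precVar A q)
    (ht : 8 * (‖toEuclideanCLM (𝕜 := ℝ) A‖ + 1) * √(Fintype.card ι) ≤ t / Fintype.card ι)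
    {δ : ι → ℝ} (hδ : ∀ k, δ k = n k - balancedDivision A t k) :
    δ ⬝ᵥ (precision A n)⁻¹ *ᵥ δ ≤ Fintype.card ι * (8 / (7 * (t / Fintype.card ι))) := by
  set R := ‖toEuclideanCLM (𝕜 := ℝ) A‖
  set T := (t : ℝ) / Fintype.card ι
  have hs : 1 ≤ √(Fintype.card ι : ℝ) :=
    Real.one_le_sqrt.2 (Nat.one_le_cast.2 Fintype.card_pos)
  have hRs : 0 ≤ R * √(Fintype.card ι) := by positivity
  have hT : 0 < T := by linarith
  have hlevel : 0 < balancedLevel A t := hT.trans_le (div_card_le_balancedLevel hA.posSemidef t)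
  have hbal (k : ι) : T - R * √(Fintype.card ι) ≤ balancedDivision A t k :=
    sub_le_sub (div_card_le_balancedLevel hA.posSemidef t)
      ((le_abs_self _).trans (abs_mulVec_one_le A k))
  obtain ⟨m, hm, hround⟩ := exists_nat_abs_sub_le_one (balancedDivision A t)
    (fun k => by linarith [hbal k]) t (sum_balancedDivision A t)
  set r : ι → ℝ := fun k => m k - balancedDivision A t k
  have hm_ge (k : ι) : 7 / 8 * T ≤ m k := by linarith [hbal k, (abs_le.1 (hround k)).1]
  have hle : δ ⬝ᵥ (precision A n)⁻¹ *ᵥ δ ≤ r ⬝ᵥ (precision A m)⁻¹ *ᵥ r := by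
    have hvar := hmin m hm
    rw [precVar_eq_add hA hlevel.ne' hn hδ, precVar_eq_add hA hlevel.ne' hm fun _ => rfl] at hvar
    exact (div_le_div_iff_of_pos_right (by positivity)).1 (le_of_add_le_add_left hvar)
  calc δ ⬝ᵥ (precision A n)⁻¹ *ᵥ δ ≤ ∑ k, r k ^ 2 / m k :=
        hle.trans (dotProduct_inv_add_diagonal_mulVec_le hA.posSemidef
          (fun k => lt_of_lt_of_le (by positivity) (hm_ge k)) r)
    _ ≤ ∑ _k : ι, 1 / (7 / 8 * T) := by
        gcongr with k
        · rw [← sq_abs]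
          exact pow_le_one₀ (abs_nonneg _) (hround k)
        · exact hm_ge k
    _ = Fintype.card ι * (8 / (7 * T)) := by
        rw [Finset.sum_const, Finset.card_univ, nsmul_eq_mul]
        field_simp

lemma abs_sub_balancedDivision_le_of_isMin [Nonempty ι] (hA : A.PosDef) (hn : ∑ k, n k = t)
    (hmin : ∀ q : ι → ℕ, ∑ k, q k = t → precVar A n ≤ precVar A q)
    (ht : 8 * (‖toEuclideanCLM (𝕜 := ℝ) A‖ + 1) * √(Fintype.card ι) ≤ t / Fintype.card ι) (i : ι) :
    |n i - balancedDivision A t i| ≤ 2 * √(Fintype.card ι) := by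
  set R := ‖toEuclideanCLM (𝕜 := ℝ) A‖
  set T := (t : ℝ) / Fintype.card ι
  set s := √(Fintype.card ι : ℝ)
  set δ : ι → ℝ := fun k => n k - balancedDivision A t k
  have hs : 1 ≤ s := Real.one_le_sqrt.2 (Nat.one_le_cast.2 Fintype.card_pos)
  have hR : 0 ≤ R := norm_nonneg _
  have hRs : R ≤ R * s := le_mul_of_one_le_right hR hs
  have hT : 0 < T := by linarith
  have hn_le : (n i : ℝ) ≤ T + R + R * s + |δ i| := by
    have hdef : (n i : ℝ) = δ i + (balancedLevel A t - (A *ᵥ 1) i) := by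
      simp only [δ, balancedDivision]
      ring
    linarith [balancedLevel_le A t, (abs_le.1 (abs_mulVec_one_le A i)).1, le_abs_self (δ i)]
  have hquad : |δ i| ^ 2 ≤ (T + 3 * (R * s) + |δ i|) * (s * s * (8 / (7 * T))) := by
    calc |δ i| ^ 2 ≤ precision A n i i * (δ ⬝ᵥ (precision A n)⁻¹ *ᵥ δ) := by
          simpa [sq_abs] using sq_dotProduct_le (precision_posDef hA n) (Pi.single i 1) δ
      _ ≤ precision A n i i * (s * s * (8 / (7 * T))) := by
          rw [Real.mul_self_sqrt (Nat.cast_nonneg _)]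
          exact mul_le_mul_of_nonneg_left
            (dotProduct_inv_mulVec_le_of_isMin hA hn hmin ht fun _ => rfl)
            (precision_posDef hA n).diag_pos.le
      _ ≤ (T + 3 * (R * s) + |δ i|) * (s * s * (8 / (7 * T))) := by
          refine mul_le_mul_of_nonneg_right ?_ (by positivity)
          rw [precision, Matrix.add_apply, diagonal_apply_eq]
          linarith [(le_abs_self _).trans (abs_apply_self_le A i)]
  refine le_two_mul_of_quadratic hs hR ht (abs_nonneg (δ i)) ?_
  have hassoc : (T + 3 * (R * s) + |δ i|) * (s * s * (8 / (7 * T))) =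
      8 * (T + 3 * (R * s) + |δ i|) * (s * s) / (7 * T) := by ring
  rw [hassoc, le_div_iff₀ (by positivity)] at hquad
  linarith

lemma abs_sub_div_card_le_of_isMin [Nonempty ι] (hA : A.PosDef) (hn : ∑ k, n k = t)
    (hmin : ∀ q : ι → ℕ, ∑ k, q k = t → precVar A n ≤ precVar A q)
    (ht : 8 * (‖toEuclideanCLM (𝕜 := ℝ) A‖ + 1) * Fintype.card ι * √(Fintype.card ι) ≤ t) (i : ι) :
    |(n i : ℝ) - t / Fintype.card ι| ≤
      4 * (‖toEuclideanCLM (𝕜 := ℝ) A‖ + 1) * √(Fintype.card ι) := by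
  have hcard : (0 : ℝ) < Fintype.card ι := Nat.cast_pos.2 Fintype.card_pos
  have hs : 1 ≤ √(Fintype.card ι : ℝ) :=
    Real.one_le_sqrt.2 (Nat.one_le_cast.2 Fintype.card_pos)
  have hRs := le_mul_of_one_le_right (norm_nonneg (toEuclideanCLM (𝕜 := ℝ) A)) hs
  have hT : 8 * (‖toEuclideanCLM (𝕜 := ℝ) A‖ + 1) * √(Fintype.card ι) ≤ t / Fintype.card ι :=
    (le_div_iff₀ hcard).2 (by linarith)
  have hδ := abs_le.1 (abs_sub_balancedDivision_le_of_isMin hA hn hmin hT i)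
  have hrow := abs_le.1 (abs_mulVec_one_le A i)
  have hlevel := balancedLevel_le A t
  have hlevel' := div_card_le_balancedLevel hA.posSemidef t
  rw [balancedDivision] at hδ
  rw [abs_le]
  constructor <;> linarith [hδ.1, hδ.2, hrow.1, hrow.2]

end Division

section GaussianCombinations

variable {Ω Ω' ι : Type*} {mΩ : MeasurableSpace Ω} {mΩ' : MeasurableSpace Ω'} {P : Measure Ω}
  {Q : Measure Ω'}

lemma hasGaussianLaw_comp_of_measurePreserving {X : Ω' → ℝ} (hX : HasGaussianLaw X Q)
    {f : Ω → Ω'} (hf : MeasurePreserving f P Q) : HasGaussianLaw (X ∘ f) P where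
  isGaussian_map := by
    rw [← AEMeasurable.map_map_of_aemeasurable (hf.map_eq ▸ hX.aemeasurable) hf.aemeasurable,
      hf.map_eq]
    exact hX.isGaussian_map

lemma hasGaussianLaw_linearCombination {X : ι → Ω → ℝ} (hX : IsGaussianProcess X P)
    (β : ι →₀ ℝ) : HasGaussianLaw (Finsupp.linearCombination ℝ X β) P :=
  (hX.smul β).hasGaussianLaw_sum (I := β.support)

lemma covariance_linearCombination {X : ι → Ω → ℝ} [DecidableEq ι] [IsFiniteMeasure P]
    (hX : ∀ i, MemLp (X i) 2 P) (hcov : ∀ i j, cov[X i, X j; P] = if i = j then 1 else 0)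
    (β β' : ι →₀ ℝ) :
    cov[Finsupp.linearCombination ℝ X β, Finsupp.linearCombination ℝ X β'; P] =
      Finsupp.linearCombination ℝ β β' := by
  simp only [Finsupp.linearCombination_apply, Finsupp.sum]
  rw [covariance_sum_sum' (fun i _ => (hX i).const_smul _) (fun i _ => (hX i).const_smul _),
    Finset.sum_comm]
  refine Finset.sum_congr rfl fun j _ => ?_
  simp only [covariance_smul_left, covariance_smul_right, hcov, mul_ite, mul_one, mul_zero,
    Finset.sum_ite_eq', smul_eq_mul]
  grind [Finsupp.notMem_support_iff]

lemma isGaussianProcess_of_linear {V : Type*} [AddCommGroup V] [Module ℝ V]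
    {L : V →ₗ[ℝ] (Ω → ℝ)} (hL : ∀ x, HasGaussianLaw (L x) P) :
    IsGaussianProcess (fun x => L x) P where
  hasGaussianLaw I := by
    classical
    have hmeas : AEMeasurable (fun ω => I.restrict fun x => L x ω) P :=
      aemeasurable_pi_lambda _ fun x => (hL x).aemeasurable
    refine ⟨⟨fun Λ => ?_⟩⟩
    have hΛ : Λ ∘ (fun ω => I.restrict fun x => L x ω) =
        L (∑ x : I, Λ (fun y => if x = y then 1 else 0) • (x : V)) := by
      ext ω
      have h := Λ.toLinearMap.pi_apply_eq_sum_univ (I.restrict fun x => L x ω)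
      simpa [mul_comm] using h
    rw [AEMeasurable.map_map_of_aemeasurable Λ.continuous.aemeasurable hmeas, hΛ,
      (hL _).map_eq_gaussianReal, ← hΛ, variance_map Λ.continuous.aemeasurable hmeas,
      integral_map hmeas Λ.continuous.aestronglyMeasurable]
    rfl

lemma indepFun_of_covariance_linear_eq_zero {V : Type*} [AddCommGroup V] [Module ℝ V]
    {L : V →ₗ[ℝ] (Ω → ℝ)} (hL : ∀ x, HasGaussianLaw (L x) P) {x : V} {y : ι → V}
    (hxy : ∀ i, cov[L x, L (y i); P] = 0) :
    IndepFun (L x) (fun ω i => L (y i) ω) P := by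
  have hjoint : IsGaussianProcess (Sum.elim (fun _ : Unit => L x) fun i => L (y i)) P :=
    (isGaussianProcess_of_linear hL).comp_right (Sum.elim (fun _ => x) y) |>.congr
      (by rintro (_ | _) <;> rfl)
  exact (hjoint.indepFun_of_covariance_eq_zero (fun _ => (hL x).aemeasurable)
    (fun i => (hL (y i)).aemeasurable) fun _ => hxy).comp (measurable_pi_apply ()) measurable_id

end GaussianCombinations

namespace Environment

variable {K : ℕ} (E : Environment K)

instance : IsProbabilityMeasure E.P := by
  unfold P
  infer_instance

@[fun_prop]
lemma measurable_transformedState (k : Fin K) : Measurable (E.transformedState k) := by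
  unfold transformedState
  fun_prop

@[fun_prop]
lemma measurable_signal (n : ℕ) (k : Fin K) : Measurable (E.signal n k) := by
  unfold signal
  fun_prop

/-- The transformed state as a continuous linear functional. -/
def stateCLM (k : Fin K) : EuclideanSpace ℝ (Fin K) →L[ℝ] ℝ :=
  (1 / E.σ k) • ∑ j, E.C k j • EuclideanSpace.proj (𝕜 := ℝ) j

lemma stateCLM_apply (k : Fin K) (θ : EuclideanSpace ℝ (Fin K)) :
    E.stateCLM k θ = E.transformedState k θ := by
  simp [stateCLM, transformedState]

lemma coe_stateCLM (k : Fin K) : ⇑(E.stateCLM k) = E.transformedState k :=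
  funext (E.stateCLM_apply k)

lemma transformedCov_eq_mul_mul_conjTranspose :
    E.transformedCov = (diagonal (fun k => 1 / E.σ k) * E.C) * E.V *
      (diagonal (fun k => 1 / E.σ k) * E.C)ᴴ := by
  set M : Matrix (Fin K) (Fin K) ℝ := diagonal (fun k => 1 / E.σ k) * E.C with hM
  have hmem : ∀ j, MemLp (fun θ : EuclideanSpace ℝ (Fin K) => θ j) 2
      (multivariateGaussian E.mean E.V) := fun j =>
    IsGaussian.memLp_dual _ (EuclideanSpace.proj (𝕜 := ℝ) j) 2 (by simp)
  have hstate : ∀ i, E.transformedState i = fun θ => ∑ j, M i j * θ j := fun i => by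
    ext θ
    simp [transformedState, hM, diagonal_mul, Finset.mul_sum, mul_assoc]
  ext i k
  rw [transformedCov, of_apply, hstate, hstate, covariance_fun_sum_fun_sum
    (fun j => (hmem j).const_mul _) (fun j => (hmem j).const_mul _)]
  simp_rw [covariance_const_mul_left, covariance_const_mul_right,
    covariance_eval_multivariateGaussian E.V_posDef.posSemidef]
  simp only [mul_apply (M := M * E.V), mul_apply (M := M) (N := E.V), conjTranspose_apply,
    star_trivial, Finset.sum_mul]
  rw [Finset.sum_comm]
  exact Finset.sum_congr rfl fun _ _ => Finset.sum_congr rfl fun _ _ => by ring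

lemma transformedCov_posDef : E.transformedCov.PosDef := by
  rw [transformedCov_eq_mul_mul_conjTranspose]
  refine E.V_posDef.mul_mul_conjTranspose_same (vecMul_injective_of_isUnit ?_)
  rw [isUnit_iff_isUnit_det, det_mul, det_diagonal]
  refine IsUnit.mul ?_ E.C_invertible
  rw [isUnit_iff_ne_zero, Finset.prod_ne_zero_iff]
  exact fun k _ => one_div_ne_zero (E.σ_pos k).ne'

section CenteredVariables

/-- The standard normal noise of a potential realization. -/
def noise (p : ℕ × Fin K) (ω : Sample K) : ℝ := ω.2 p

/-- The deviation of a transformed state from its prior mean. -/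
def deviation (k : Fin K) (ω : Sample K) : ℝ :=
  E.transformedState k ω.1 - E.transformedState k E.mean

/-- The coefficients of a centered Gaussian variable of the model: on the deviations of the
transformed states, and on the noise terms. -/
abbrev Coeff (K : ℕ) : Type := (Fin K → ℝ) × (ℕ × Fin K →₀ ℝ)

/-- The centered Gaussian variables of the model, parametrized linearly by their coefficients. -/
def lin : Coeff K →ₗ[ℝ] (Sample K → ℝ) :=
  (Fintype.linearCombination ℝ E.deviation).coprod (Finsupp.linearCombination ℝ noise)

lemma measurePreserving_state :
    MeasurePreserving Prod.fst E.P (multivariateGaussian E.mean E.V) :=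
  measurePreserving_fst

lemma measurePreserving_noise :
    MeasurePreserving Prod.snd E.P
      (Measure.infinitePi fun _ : ℕ × Fin K => gaussianReal 0 1) :=
  measurePreserving_snd

lemma measurePreserving_noise_apply (p : ℕ × Fin K) :
    MeasurePreserving (noise p) E.P (gaussianReal 0 1) :=
  (measurePreserving_eval_infinitePi _ p).comp E.measurePreserving_noise

lemma iIndepFun_noise : iIndepFun noise E.P := by
  rw [iIndepFun_iff_map_fun_eq_infinitePi_map fun _ => by unfold noise; fun_prop]
  simp_rw [(E.measurePreserving_noise_apply _).map_eq]
  exact E.measurePreserving_noise.map_eq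

lemma isGaussianProcess_noise : IsGaussianProcess noise E.P where
  hasGaussianLaw _ := iIndepFun.hasGaussianLaw
    (fun p => (E.measurePreserving_noise_apply p).hasLaw.hasGaussianLaw)
    (E.iIndepFun_noise.precomp Subtype.val_injective)

lemma memLp_noise (p : ℕ × Fin K) : MemLp (noise p) 2 E.P :=
  (E.isGaussianProcess_noise.hasGaussianLaw_eval p).memLp_two

lemma covariance_noise (p p' : ℕ × Fin K) :
    cov[noise p, noise p'; E.P] = if p = p' then 1 else 0 := by
  split_ifs with h
  · subst h
    rw [covariance_self (E.memLp_noise p).aemeasurable,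
      (E.measurePreserving_noise_apply p).hasLaw.variance_eq, variance_id_gaussianReal]
    simp
  · exact (E.iIndepFun_noise.indepFun h).covariance_eq_zero (E.memLp_noise p) (E.memLp_noise p')

lemma memLp_transformedState (k : Fin K) :
    MemLp (E.transformedState k) 2 (multivariateGaussian E.mean E.V) :=
  E.coe_stateCLM k ▸ IsGaussian.memLp_dual _ (E.stateCLM k) 2 (by simp)

lemma memLp_deviation (k : Fin K) : MemLp (E.deviation k) 2 E.P :=
  ((E.memLp_transformedState k).comp_measurePreserving E.measurePreserving_state).sub
    (memLp_const _)

lemma covariance_deviation (k k' : Fin K) :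
    cov[E.deviation k, E.deviation k'; E.P] = E.transformedCov k k' := by
  have hint : ∀ k, Integrable (fun ω : Sample K => E.transformedState k ω.1) E.P := fun k =>
    ((E.memLp_transformedState k).integrable (by norm_num)).comp_fst _
  unfold deviation
  rw [covariance_sub_const_left (hint k), covariance_sub_const_right (hint k'),
    E.measurePreserving_state.hasLaw.covariance_fun_comp
      (E.measurable_transformedState k).aemeasurable
      (E.measurable_transformedState k').aemeasurable, transformedCov, of_apply]

lemma integral_noise (p : ℕ × Fin K) : ∫ ω, noise p ω ∂E.P = 0 := by
  rw [(E.measurePreserving_noise_apply p).hasLaw.integral_eq, integral_id_gaussianReal]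

lemma integral_deviation (k : Fin K) : ∫ ω, E.deviation k ω ∂E.P = 0 := by
  have hint : Integrable (fun ω : Sample K => E.transformedState k ω.1) E.P :=
    ((E.memLp_transformedState k).integrable (by norm_num)).comp_fst _
  have hmean : ∫ ω : Sample K, E.transformedState k ω.1 ∂E.P = E.transformedState k E.mean := by
    rw [← Function.comp_def (E.transformedState k), E.measurePreserving_state.hasLaw.integral_comp
      (E.measurable_transformedState k).aestronglyMeasurable, ← coe_stateCLM,
      ContinuousLinearMap.integral_comp_comm _ IsGaussian.integrable_fun_id,
      integral_id_multivariateGaussian]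
  unfold deviation
  rw [integral_sub hint (integrable_const _), hmean]
  simp

lemma lin_apply (x : Coeff K) (ω : Sample K) :
    E.lin x ω = ∑ k, x.1 k * E.deviation k ω + x.2.sum fun p c => c * noise p ω := by
  simp [lin, Fintype.linearCombination_apply, Finsupp.linearCombination_apply, Finsupp.sum]

lemma hasGaussianLaw_deviation_combination (α : Fin K → ℝ) :
    HasGaussianLaw (Fintype.linearCombination ℝ E.deviation α) E.P := by
  have h : Fintype.linearCombination ℝ E.deviation α =
      (fun θ => (∑ k, α k • E.stateCLM k) (θ - E.mean)) ∘ Prod.fst := by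
    ext ω
    simp [Fintype.linearCombination_apply, deviation, ← stateCLM_apply, mul_sub]
  rw [h]
  refine hasGaussianLaw_comp_of_measurePreserving ?_ E.measurePreserving_state
  exact (IsGaussian.hasGaussianLaw (X := fun θ => θ - E.mean)).map_fun _

lemma indepFun_deviation_combination_noise_combination
    (α : Fin K → ℝ) (β : ℕ × Fin K →₀ ℝ) :
    IndepFun (Fintype.linearCombination ℝ E.deviation α)
      (Finsupp.linearCombination ℝ noise β) E.P := by
  have h := indepFun_prod (μ := multivariateGaussian E.mean E.V)
    (ν := Measure.infinitePi fun _ : ℕ × Fin K => gaussianReal 0 1)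
    (X := fun θ => ∑ k, α k * (E.transformedState k θ - E.transformedState k E.mean))
    (Y := fun z => ∑ p ∈ β.support, β p * z p) (by fun_prop) (by fun_prop)
  convert! h using 1
  · ext ω
    simp [Fintype.linearCombination_apply, deviation]
  · ext ω
    simp [Finsupp.linearCombination_apply, Finsupp.sum, noise]

lemma hasGaussianLaw_lin (x : Coeff K) : HasGaussianLaw (E.lin x) E.P :=
  iIndepFun.hasGaussianLaw_add (E.hasGaussianLaw_deviation_combination x.1)
    (hasGaussianLaw_linearCombination E.isGaussianProcess_noise x.2)
    (E.indepFun_deviation_combination_noise_combination x.1 x.2)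

lemma memLp_lin (x : Coeff K) : MemLp (E.lin x) 2 E.P :=
  (E.hasGaussianLaw_lin x).memLp_two

lemma integral_lin (x : Coeff K) : ∫ ω, E.lin x ω ∂E.P = 0 := by
  have hdev : ∀ k, Integrable (E.deviation k) E.P := fun k =>
    (E.memLp_deviation k).integrable (by norm_num)
  have hnoise : ∀ p, Integrable (noise p) E.P := fun p =>
    (E.memLp_noise p).integrable (by norm_num)
  simp_rw [lin_apply, Finsupp.sum]
  rw [integral_add (integrable_finsetSum _ fun k _ => (hdev k).const_mul _)
      (integrable_finsetSum _ fun p _ => (hnoise p).const_mul _),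
    integral_finsetSum _ fun k _ => (hdev k).const_mul _,
    integral_finsetSum _ fun p _ => (hnoise p).const_mul _]
  simp_rw [integral_const_mul, E.integral_deviation, E.integral_noise]
  simp

lemma covariance_deviation_combination (α α' : Fin K → ℝ) :
    cov[Fintype.linearCombination ℝ E.deviation α, Fintype.linearCombination ℝ E.deviation α';
      E.P] = α ⬝ᵥ E.transformedCov *ᵥ α' := by
  simp only [Fintype.linearCombination_apply]
  rw [covariance_sum_sum (fun k => (E.memLp_deviation k).const_smul _)
    (fun k => (E.memLp_deviation k).const_smul _)]
  simp only [covariance_smul_left, covariance_smul_right, covariance_deviation, dotProduct, mulVec,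
    Finset.mul_sum]
  exact Finset.sum_congr rfl fun _ _ => Finset.sum_congr rfl fun _ _ => by ring

lemma covariance_lin (x y : Coeff K) :
    cov[E.lin x, E.lin y; E.P] =
      x.1 ⬝ᵥ E.transformedCov *ᵥ y.1 + Finsupp.linearCombination ℝ x.2 y.2 := by
  have hdev : ∀ α, MemLp (Fintype.linearCombination ℝ E.deviation α) 2 E.P := fun α =>
    (E.hasGaussianLaw_deviation_combination α).memLp_two
  have hnoise : ∀ β, MemLp (Finsupp.linearCombination ℝ noise β) 2 E.P := fun β =>
    (hasGaussianLaw_linearCombination E.isGaussianProcess_noise β).memLp_two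
  have hcross : ∀ α β, cov[Fintype.linearCombination ℝ E.deviation α,
      Finsupp.linearCombination ℝ noise β; E.P] = 0 := fun α β =>
    (E.indepFun_deviation_combination_noise_combination α β).covariance_eq_zero (hdev α) (hnoise β)
  rw [lin, LinearMap.coprod_apply, LinearMap.coprod_apply,
    covariance_add_left (hdev _) (hnoise _) ((hdev _).add (hnoise _)),
    covariance_add_right (hdev _) (hdev _) (hnoise _),
    covariance_add_right (hnoise _) (hdev _) (hnoise _), hcross,
    covariance_comm (Finsupp.linearCombination ℝ noise x.2), hcross,
    covariance_deviation_combination, covariance_linearCombination E.memLp_noise E.covariance_noise]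
  ring

lemma indepFun_lin {ι : Type*} {x : Coeff K}
    {y : ι → Coeff K} (hxy : ∀ i, cov[E.lin x, E.lin (y i); E.P] = 0) :
    IndepFun (E.lin x) (fun ω i => E.lin (y i) ω) E.P :=
  indepFun_of_covariance_linear_eq_zero E.hasGaussianLaw_lin hxy

lemma map_lin (x : Coeff K) :
    E.P.map (E.lin x) = gaussianReal 0 (cov[E.lin x, E.lin x; E.P]).toNNReal := by
  rw [(E.hasGaussianLaw_lin x).map_eq_gaussianReal, E.integral_lin,
    covariance_self (E.memLp_lin x).aemeasurable]

end CenteredVariables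

/-- How often each source occurs in a finite family of sources; `tally` is the case of the sources
observed in one period. -/
def count {ι : Type*} [Fintype ι] (κ : ι → Fin K) (k : Fin K) : ℕ :=
  (Finset.univ.filter fun i => κ i = k).card

lemma sum_comp_eq_sum_count {ι : Type*} [Fintype ι] (κ : ι → Fin K) (f : Fin K → ℝ) :
    ∑ i, f (κ i) = ∑ k, count κ k * f k := by
  rw [← Finset.sum_fiberwise' Finset.univ κ f]
  simp [count]

lemma count_sigma_fst (q : Fin K → ℕ) :
    (count fun p : (k : Fin K) × Fin (q k) => p.1) = q := by
  ext k
  rw [count, Finset.card_filter, Fintype.sum_sigma, Finset.sum_eq_single k]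
  · simp
  · intro k' _ hk'
    simp [hk']
  · simp

section Posterior

variable {ι ι' : Type*} [Fintype ι] [Fintype ι']

/-- The weight of a realization of source `k`, in units of its noise, in the posterior mean of the
sum of the transformed states after the division `q`. -/
def weight (q : Fin K → ℕ) (k : Fin K) : ℝ := precWeight E.transformedCov⁻¹ q k

/-- The posterior variance of the sum of the transformed states after the division `q`. -/
def stateVar (q : Fin K → ℕ) : ℝ := precVar E.transformedCov⁻¹ q

/-- The posterior mean of the sum of the transformed states, given the realizations `x` of the
sources `κ`. -/
def postMean (κ : ι → Fin K) (x : ι → ℝ) : ℝ :=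
  ∑ k, E.transformedState k E.mean + ∑ i, E.weight (count κ) (κ i) *
    (x i / E.σ (κ i) - E.transformedState (κ i) E.mean)

@[fun_prop]
lemma measurable_postMean (κ : ι → Fin K) : Measurable (E.postMean κ) := by
  unfold postMean
  fun_prop

lemma transformedCov_inv_mulVec_weight (q : Fin K → ℕ) (k : Fin K) :
    (E.transformedCov⁻¹ *ᵥ E.weight q) k = 1 - q k * E.weight q k := by
  have h := congrFun (precision_mulVec_precWeight E.transformedCov_posDef.inv q) k
  rw [precision_mulVec_apply, Pi.one_apply] at h
  exact eq_sub_of_add_eq h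

lemma stateVar_nonneg (q : Fin K → ℕ) : 0 ≤ E.stateVar q :=
  precVar_nonneg E.transformedCov_posDef.inv q

lemma stateVar_antitone : Antitone E.stateVar := precVar_antitone E.transformedCov_posDef.inv

/-- The realizations indexed by `s`. -/
def obs {ι : Type*} (s : ι → ℕ × Fin K) (ω : Sample K) (i : ι) : ℝ := E.signal (s i).1 (s i).2 ω

@[fun_prop]
lemma measurable_obs {ι : Type*} (s : ι → ℕ × Fin K) : Measurable (E.obs s) := by
  unfold obs
  fun_prop

/-- The coefficients of the centered realization `p`, in units of its noise. -/
def obsCoeff (p : ℕ × Fin K) : Coeff K := (Pi.single p.2 1, Finsupp.single p 1)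

/-- The coefficients of the centered sum of the transformed states. -/
def stateCoeff : Coeff K := (1, 0)

/-- The coefficients of the part of the sum of the transformed states that the realizations `s`
leave unexplained. -/
def residCoeff (s : ι → ℕ × Fin K) : Coeff K :=
  stateCoeff - ∑ i, E.weight (count fun i => (s i).2) (s i).2 • obsCoeff (s i)

lemma signal_eq_lin (n : ℕ) (k : Fin K) (ω : Sample K) :
    E.signal n k ω = E.σ k * (E.transformedState k E.mean + E.lin (obsCoeff (n, k)) ω) := by
  have hσ : E.σ k ≠ 0 := (E.σ_pos k).ne'
  simp only [signal, lin_apply, obsCoeff, deviation, noise, transformedState, Pi.single_apply,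
    one_div, ite_mul, one_mul, zero_mul, Finset.sum_ite_eq', Finset.mem_univ, if_true,
    Finsupp.sum_single_index]
  field_simp
  ring

lemma indepFun_lin_obs {ι : Type*} {s : ι → ℕ × Fin K} {x : Coeff K}
    (hx : ∀ i, cov[E.lin x, E.lin (obsCoeff (s i)); E.P] = 0) :
    IndepFun (E.lin x) (E.obs s) E.P := by
  have hobs : E.obs s = (fun y i => E.σ (s i).2 * (E.transformedState (s i).2 E.mean + y i)) ∘
      fun ω i => E.lin (obsCoeff (s i)) ω := by
    ext ω i
    exact E.signal_eq_lin _ _ ω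
  rw [hobs]
  exact (E.indepFun_lin hx).comp measurable_id (by fun_prop)

lemma fst_residCoeff (s : ι → ℕ × Fin K) : (E.residCoeff s).1 =
    E.transformedCov⁻¹ *ᵥ E.weight (count fun i => (s i).2) := by
  ext k
  have hsum := sum_comp_eq_sum_count (fun i => (s i).2)
    fun k' => E.weight (count fun i => (s i).2) k' * (Pi.single k' 1 : Fin K → ℝ) k
  rw [transformedCov_inv_mulVec_weight]
  simpa [residCoeff, stateCoeff, obsCoeff, Prod.fst_sum, Pi.single_apply] using hsum

lemma fst_residCoeff_dotProduct (s : ι → ℕ × Fin K) (x : Fin K → ℝ) :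
    (E.residCoeff s).1 ⬝ᵥ E.transformedCov *ᵥ x = x ⬝ᵥ E.weight (count fun i => (s i).2) := by
  rw [fst_residCoeff, dotProduct_mulVec_comm
    (isHermitian_iff_isSymm.1 E.transformedCov_posDef.isHermitian),
    mulVec_inv_mulVec E.transformedCov_posDef.isUnit]

lemma snd_residCoeff_apply {s : ι → ℕ × Fin K} (hs : Function.Injective s) (i : ι) :
    (E.residCoeff s).2 (s i) = -E.weight (count fun i => (s i).2) (s i).2 := by
  classical
  simp [residCoeff, stateCoeff, obsCoeff, Prod.snd_sum, Finsupp.single_apply, hs.eq_iff]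

lemma covariance_residCoeff_obsCoeff {s : ι → ℕ × Fin K} (hs : Function.Injective s) (i : ι) :
    cov[E.lin (E.residCoeff s), E.lin (obsCoeff (s i)); E.P] = 0 := by
  rw [covariance_lin, fst_residCoeff_dotProduct]
  simp [obsCoeff, E.snd_residCoeff_apply hs]

lemma covariance_residCoeff_stateCoeff (s : ι → ℕ × Fin K) :
    cov[E.lin (E.residCoeff s), E.lin stateCoeff; E.P] =
      E.stateVar (count fun i => (s i).2) := by
  rw [covariance_lin, fst_residCoeff_dotProduct]
  simp [stateCoeff, stateVar, precVar, one_dotProduct, weight]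

lemma covariance_residCoeff_residCoeff {s : ι → ℕ × Fin K} {s' : ι' → ℕ × Fin K}
    (hs' : Function.Injective s') (hss' : Set.range s ⊆ Set.range s') :
    cov[E.lin (E.residCoeff s'), E.lin (E.residCoeff s); E.P] =
      E.stateVar (count fun i => (s' i).2) := by
  have hobs : ∀ i, cov[E.lin (E.residCoeff s'), E.lin (obsCoeff (s i)); E.P] = 0 := fun i => by
    obtain ⟨j, hj⟩ := hss' ⟨i, rfl⟩
    exact hj ▸ E.covariance_residCoeff_obsCoeff hs' j
  conv_lhs => rw [residCoeff.eq_1 E s, map_sub, map_sum]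
  simp_rw [map_smul]
  rw [covariance_sub_right (E.memLp_lin _) (E.memLp_lin _)
      (memLp_finsetSum' _ fun i _ => (E.memLp_lin _).const_smul _),
    covariance_sum_right (fun i => (E.memLp_lin _).const_smul _) (E.memLp_lin _),
    covariance_residCoeff_stateCoeff]
  simp [covariance_smul_right, hobs]

/-- The revision of the posterior mean when the realizations `s'` replace the realizations `s`. -/
def revision (s : ι → ℕ × Fin K) (s' : ι' → ℕ × Fin K) (ω : Sample K) : ℝ :=
  E.postMean (fun i => (s' i).2) (E.obs s' ω) - E.postMean (fun i => (s i).2) (E.obs s ω)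

variable [NeZero K]

/-- The difference between the payoff-relevant state and its posterior mean. -/
def resid (s : ι → ℕ × Fin K) (ω : Sample K) : ℝ :=
  ω.1 0 - E.postMean (fun i => (s i).2) (E.obs s ω)

@[fun_prop]
lemma measurable_resid (s : ι → ℕ × Fin K) : Measurable (E.resid s) := by
  unfold resid
  fun_prop

variable (hw : ∀ θ : EuclideanSpace ℝ (Fin K), θ 0 = ∑ k, E.transformedState k θ)

include hw

lemma resid_eq_lin (s : ι → ℕ × Fin K) : E.resid s = E.lin (E.residCoeff s) := by
  ext ω
  have hstate : ω.1 0 = ∑ k, E.transformedState k E.mean + E.lin stateCoeff ω := by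
    simp [hw, stateCoeff, lin_apply, deviation]
  have hobs : ∀ i, E.obs s ω i / E.σ (s i).2 - E.transformedState (s i).2 E.mean =
      E.lin (obsCoeff (s i)) ω := fun i => by
    rw [obs, signal_eq_lin, mul_div_cancel_left₀ _ (E.σ_pos _).ne', add_sub_cancel_left]
  rw [resid, postMean, hstate, residCoeff, map_sub, map_sum]
  simp [hobs]

lemma revision_eq_lin (s : ι → ℕ × Fin K) (s' : ι' → ℕ × Fin K) :
    E.revision s s' = E.lin (E.residCoeff s - E.residCoeff s') := by
  rw [map_sub, ← E.resid_eq_lin hw, ← E.resid_eq_lin hw]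
  ext ω
  simp [revision, resid]

lemma memLp_resid (s : ι → ℕ × Fin K) : MemLp (E.resid s) 2 E.P :=
  E.resid_eq_lin hw s ▸ E.memLp_lin _

lemma integral_resid (s : ι → ℕ × Fin K) : ∫ ω, E.resid s ω ∂E.P = 0 := by
  rw [E.resid_eq_lin hw, integral_lin]

variable {s : ι → ℕ × Fin K} {s' : ι' → ℕ × Fin K}

lemma variance_resid (hs : Function.Injective s) :
    Var[E.resid s; E.P] = E.stateVar (count fun i => (s i).2) := by
  rw [← covariance_self (E.measurable_resid s).aemeasurable, E.resid_eq_lin hw,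
    E.covariance_residCoeff_residCoeff hs subset_rfl]

lemma map_resid (hs : Function.Injective s) :
    E.P.map (E.resid s) = gaussianReal 0 (E.stateVar (count fun i => (s i).2)).toNNReal := by
  rw [E.resid_eq_lin hw, map_lin, E.covariance_residCoeff_residCoeff hs subset_rfl]

lemma map_revision (hs : Function.Injective s) (hs' : Function.Injective s')
    (hss' : Set.range s ⊆ Set.range s') :
    E.P.map (E.revision s s') = gaussianReal 0 (E.stateVar (count fun i => (s i).2) -
      E.stateVar (count fun i => (s' i).2)).toNNReal := by
  rw [E.revision_eq_lin hw, map_lin, map_sub,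
    covariance_sub_left (E.memLp_lin _) (E.memLp_lin _) ((E.memLp_lin _).sub (E.memLp_lin _)),
    covariance_sub_right (E.memLp_lin _) (E.memLp_lin _) (E.memLp_lin _),
    covariance_sub_right (E.memLp_lin _) (E.memLp_lin _) (E.memLp_lin _),
    covariance_comm (E.lin (E.residCoeff s)) (E.lin (E.residCoeff s')),
    E.covariance_residCoeff_residCoeff hs subset_rfl,
    E.covariance_residCoeff_residCoeff hs' subset_rfl,
    E.covariance_residCoeff_residCoeff hs' hss', sub_self, sub_zero]

lemma indepFun_resid_obs (hs : Function.Injective s) : IndepFun (E.resid s) (E.obs s) E.P :=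
  E.resid_eq_lin hw s ▸ E.indepFun_lin_obs (E.covariance_residCoeff_obsCoeff hs)

lemma indepFun_revision_obs (hs : Function.Injective s) (hs' : Function.Injective s')
    (hss' : Set.range s ⊆ Set.range s') : IndepFun (E.revision s s') (E.obs s) E.P := by
  rw [E.revision_eq_lin hw]
  refine E.indepFun_lin_obs fun i => ?_
  obtain ⟨j, hj⟩ := hss' ⟨i, rfl⟩
  rw [map_sub, covariance_sub_left (E.memLp_lin _) (E.memLp_lin _) (E.memLp_lin _),
    E.covariance_residCoeff_obsCoeff hs, ← hj, E.covariance_residCoeff_obsCoeff hs', sub_zero]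

lemma condExp_state_eq_postMean (hs : Function.Injective s) :
    E.P[fun ω : Sample K => ω.1 0 | MeasurableSpace.comap (E.obs s) inferInstance] =ᵐ[E.P]
      fun ω => E.postMean (fun i => (s i).2) (E.obs s ω) := by
  set m := MeasurableSpace.comap (E.obs s) inferInstance
  have hm : m ≤ Prod.instMeasurableSpace := (E.measurable_obs s).comap_le
  have hmean : StronglyMeasurable[m] fun ω => E.postMean (fun i => (s i).2) (E.obs s ω) :=
    ((E.measurable_postMean _).comp (comap_measurable (E.obs s))).stronglyMeasurable
  have hresid : Integrable (E.resid s) E.P := (E.memLp_resid hw s).integrable (by norm_num)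
  have hstate : Integrable (fun ω : Sample K => ω.1 0) E.P :=
    (IsGaussian.integrable_dual (multivariateGaussian E.mean E.V)
      (EuclideanSpace.proj (𝕜 := ℝ) (0 : Fin K))).comp_fst _
  have hcond : E.P[E.resid s | m] =ᵐ[E.P] fun _ => ∫ ω, E.resid s ω ∂E.P :=
    condExp_indep_eq (E.measurable_resid s).comap_le hm
      (comap_measurable (E.resid s)).stronglyMeasurable (E.indepFun_resid_obs hw hs)
  have hdecomp : (fun ω => E.postMean (fun i => (s i).2) (E.obs s ω)) =
      (fun ω : Sample K => ω.1 0) - E.resid s := by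
    ext ω
    simp [resid]
  have hsub := condExp_sub hstate hresid m
  rw [← hdecomp, condExp_of_stronglyMeasurable hm hmean (hdecomp ▸ hstate.sub hresid)] at hsub
  filter_upwards [hsub, hcond] with ω h1 h2
  rw [h1, Pi.sub_apply, h2, E.integral_resid hw, sub_zero]

lemma integral_condVar_state (hs : Function.Injective s) :
    ∫ ω, (Var[fun ω' : Sample K => ω'.1 0; E.P |
      MeasurableSpace.comap (E.obs s) inferInstance]) ω ∂E.P =
      E.stateVar (count fun i => (s i).2) := by
  rw [condVar, integral_condExp (E.measurable_obs s).comap_le, ← E.variance_resid hw hs,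
    variance_eq_integral (by fun_prop), E.integral_resid hw]
  refine integral_congr_ae ?_
  filter_upwards [E.condExp_state_eq_postMean hw hs] with ω h
  simp [h, resid]

end Posterior

lemma postVar_eq_stateVar [NeZero K]
    (hw : ∀ θ : EuclideanSpace ℝ (Fin K), θ 0 = ∑ k, E.transformedState k θ) (q : Fin K → ℕ) :
    E.postVar q = E.stateVar q := by
  have hinj : Function.Injective
      fun p : (k : Fin K) × Fin (q k) => ((p.2, p.1) : ℕ × Fin K) := by
    rintro ⟨k, i⟩ ⟨k', i'⟩ h
    obtain ⟨hi, hk⟩ := Prod.mk.inj h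
    dsimp only at hi hk
    subst hk
    rw [Fin.val_inj.1 hi]
  have h := E.integral_condVar_state hw hinj
  rwa [count_sigma_fst] at h

end Environment

section CondNormal

variable {Ω H : Type*} [MeasurableSpace Ω] [MeasurableSpace H]

/-- The joint law of a variable with law `ν` and one that is conditionally normal given it, with
conditional mean `m` and conditional variance `w` (negative values of `w` count as `0`). -/
def condNormal (ν : Measure H) (m w : H → ℝ) : Measure (H × ℝ) :=
  (ν.prod (gaussianReal 0 1)).map fun p => (p.1, m p.1 + √(w p.1) * p.2)

lemma gaussianReal_map_sqrt_mul (v : ℝ) :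
    (gaussianReal 0 1).map (fun z => √v * z) = gaussianReal 0 v.toNNReal := by
  rw [gaussianReal_map_const_mul]
  congr 1
  · simp
  · ext
    simp [Real.sq_sqrt', Real.coe_toNNReal']

lemma prod_gaussianReal_toNNReal (ν : Measure H) [SFinite ν] (v : ℝ) :
    ν.prod (gaussianReal 0 v.toNNReal) =
      (ν.prod (gaussianReal 0 1)).map (Prod.map id fun z => √v * z) := by
  rw [← Measure.map_prod_map _ _ measurable_id (by fun_prop), Measure.map_id,
    gaussianReal_map_sqrt_mul]

lemma lintegral_gaussianReal_toNNReal (v : ℝ) {g : ℝ → ℝ≥0∞} (hg : Measurable g) :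
    ∫⁻ z, g z ∂(gaussianReal 0 v.toNNReal) = ∫⁻ z, g (√v * z) ∂(gaussianReal 0 1) := by
  rw [← gaussianReal_map_sqrt_mul, lintegral_map hg (by fun_prop)]

lemma lintegral_gaussianReal_add {a b : ℝ} (ha : 0 ≤ a) (hb : 0 ≤ b) {g : ℝ → ℝ≥0∞}
    (hg : Measurable g) :
    ∫⁻ x, ∫⁻ y, g (√a * x + √b * y) ∂(gaussianReal 0 1) ∂(gaussianReal 0 1) =
      ∫⁻ z, g (√(a + b) * z) ∂(gaussianReal 0 1) := by
  have h := gaussianReal_conv_gaussianReal (m₁ := 0) (m₂ := 0) (v₁ := a.toNNReal)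
    (v₂ := b.toNNReal)
  rw [← Real.toNNReal_add ha hb, add_zero] at h
  rw [← lintegral_gaussianReal_toNNReal _ hg, ← h, Measure.lintegral_conv hg,
    lintegral_gaussianReal_toNNReal a (g := fun x => ∫⁻ y, g (x + y) ∂_)
      (Measurable.lintegral_prod_right' (f := fun p : ℝ × ℝ => g (p.1 + p.2)) (by fun_prop))]
  refine lintegral_congr fun x => ?_
  rw [lintegral_gaussianReal_toNNReal b (g := fun y => g (√a * x + y)) (by fun_prop)]

variable {ν : Measure H} {m w : H → ℝ}

lemma isProbabilityMeasure_condNormal [IsProbabilityMeasure ν] (hm : Measurable m)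
    (hw : Measurable w) : IsProbabilityMeasure (condNormal ν m w) :=
  Measure.isProbabilityMeasure_map (by fun_prop)

lemma lintegral_condNormal (hm : Measurable m) (hw : Measurable w) {g : H × ℝ → ℝ≥0∞}
    (hg : Measurable g) : ∫⁻ p, g p ∂(condNormal ν m w) =
      ∫⁻ h, ∫⁻ z, g (h, m h + √(w h) * z) ∂(gaussianReal 0 1) ∂ν := by
  rw [condNormal, lintegral_map hg (by fun_prop), lintegral_prod _ (by fun_prop)]

lemma condNormal_congr {w' : H → ℝ} (h : w =ᵐ[ν] w') :
    condNormal ν m w = condNormal ν m w' := by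
  refine Measure.map_congr ?_
  filter_upwards [Measure.quasiMeasurePreserving_fst.ae h] with p hp
  rw [hp]

lemma restrict_condNormal [SFinite ν] (hm : Measurable m) (hw : Measurable w) {s : Set H}
    (hs : MeasurableSet s) :
    (condNormal ν m w).restrict (Prod.fst ⁻¹' s) = condNormal (ν.restrict s) m w := by
  have hprod : (ν.prod (gaussianReal 0 1)).restrict (Prod.fst ⁻¹' s) =
      (ν.restrict s).prod (gaussianReal 0 1) := by
    rw [← Set.prod_univ, ← Measure.prod_restrict, Measure.restrict_univ]
  rw [condNormal, Measure.restrict_map (by fun_prop) (measurable_fst hs), condNormal, ← hprod]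
  rfl

lemma map_condNormal_prod_gaussianReal {w' : H → ℝ} (hm : Measurable m)
    (hw : Measurable w) (hw' : Measurable w') (hw0 : ∀ h, 0 ≤ w h) (hw0' : ∀ h, 0 ≤ w' h) :
    ((condNormal ν m w).prod (gaussianReal 0 1)).map
        (fun q => (q.1.1, q.1.2 + √(w' q.1.1) * q.2)) =
      condNormal ν m (fun h => w h + w' h) := by
  refine Measure.ext_of_lintegral _ fun g hg => ?_
  have hG : Measurable fun q : (H × ℝ) × ℝ => g (q.1.1, q.1.2 + √(w' q.1.1) * q.2) := by fun_prop
  rw [lintegral_map hg (by fun_prop), lintegral_prod _ (by fun_prop),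
    lintegral_condNormal hm hw hG.lintegral_prod_right',
    lintegral_condNormal (w := fun h => w h + w' h) hm (by fun_prop) hg]
  refine lintegral_congr fun x => ?_
  rw [← lintegral_gaussianReal_add (hw0 x) (hw0' x) (g := fun y => g (x, m x + y)) (by fun_prop)]
  simp_rw [add_assoc]

lemma map_condNormal_prod_gaussianReal_toNNReal [IsProbabilityMeasure ν] (hm : Measurable m)
    (hw : Measurable w) (hw0 : ∀ h, 0 ≤ w h) {a : ℝ} (ha : 0 ≤ a) :
    ((condNormal ν m w).prod (gaussianReal 0 a.toNNReal)).map (fun q => (q.1.1, q.1.2 + q.2)) =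
      condNormal ν m (fun h => w h + a) := by
  have := isProbabilityMeasure_condNormal (ν := ν) hm hw
  rw [← map_condNormal_prod_gaussianReal hm hw measurable_const hw0 fun _ => ha,
    prod_gaussianReal_toNNReal, Measure.map_map (by fun_prop) (by fun_prop)]
  rfl

variable {P : Measure Ω} {X : Ω → H} {T : Ω → ℝ}

lemma map_prod_gaussianReal_eq_condNormal [SFinite P] (hX : Measurable X) (hm : Measurable m)
    (hw : Measurable w) :
    (P.prod (gaussianReal 0 1)).map (fun p => (X p.1, m (X p.1) + √(w (X p.1)) * p.2)) =
      condNormal (P.map X) m w := by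
  have hprod : (P.map X).prod (gaussianReal 0 1) =
      (P.prod (gaussianReal 0 1)).map (Prod.map X id) := by
    rw [← Measure.map_prod_map _ _ hX measurable_id, Measure.map_id]
  rw [condNormal, hprod, Measure.map_map (by fun_prop) (by fun_prop)]
  rfl

lemma restrict_map_congr {α : Type*} [MeasurableSpace α] {f g : Ω → α} (hf : Measurable f)
    (hg : Measurable g) {s : Set α} (hs : MeasurableSet s) (hfg : f ⁻¹' s = g ⁻¹' s)
    (heq : Set.EqOn f g (f ⁻¹' s)) : (P.map f).restrict s = (P.map g).restrict s := by
  rw [Measure.restrict_map hf hs, Measure.restrict_map hg hs, ← hfg]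
  exact Measure.map_congr ((ae_restrict_iff' (hf hs)).2 (.of_forall heq))

variable [IsProbabilityMeasure P]

lemma map_prodMk_add_eq_condNormal {Z : Ω → ℝ} (hX : Measurable X) (hZ : Measurable Z)
    (hm : Measurable m) {v : ℝ} (hind : IndepFun Z X P)
    (hlaw : P.map Z = gaussianReal 0 v.toNNReal) :
    P.map (fun ω => (X ω, m (X ω) + Z ω)) = condNormal (P.map X) m fun _ => v := by
  have hjoint : P.map (fun ω => (X ω, Z ω)) =
      ((P.map X).prod (gaussianReal 0 1)).map (Prod.map id fun z => √v * z) := by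
    rw [(indepFun_iff_map_prod_eq_prod_map_map hX.aemeasurable hZ.aemeasurable).1 hind.symm, hlaw,
      prod_gaussianReal_toNNReal]
  have hmap := congrArg (Measure.map fun q : H × ℝ => (q.1, m q.1 + q.2)) hjoint
  rwa [Measure.map_map (by fun_prop) (by fun_prop),
    Measure.map_map (by fun_prop) (by fun_prop)] at hmap

lemma map_prodMk_sub_eq_prod (hX : Measurable X) (hT : Measurable T) (hm : Measurable m) {v : ℝ}
    (h : P.map (fun ω => (X ω, T ω)) = condNormal (P.map X) m fun _ => v) :
    P.map (fun ω => (X ω, T ω - m (X ω))) = (P.map X).prod (gaussianReal 0 v.toNNReal) := by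
  have hmap := congrArg (Measure.map fun q : H × ℝ => (q.1, q.2 - m q.1)) h
  rw [Measure.map_map (by fun_prop) (by fun_prop), condNormal,
    Measure.map_map (by fun_prop) (by fun_prop)] at hmap
  rw [prod_gaussianReal_toNNReal]
  refine hmap.trans (congrArg (Measure.map · _) ?_)
  ext q <;> simp

/-- A variable is conditionally normal given an observation as soon as it is the sum of `m` and an
independent normal variable in each of countably many cases that the observation distinguishes. -/
lemma map_eq_condNormal_of_cases {I : Type*} [Countable I] [MeasurableSpace I]
    [MeasurableSingletonClass I] {C : H → I} {v : I → ℝ} {Y : I → Ω → H} {Z : I → Ω → ℝ}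
    (hX : Measurable X) (hT : Measurable T) (hC : Measurable C) (hm : Measurable m)
    (hY : ∀ i, Measurable (Y i)) (hZ : ∀ i, Measurable (Z i))
    (hiff : ∀ i ω, C (X ω) = i ↔ C (Y i ω) = i) (hXY : ∀ i ω, C (X ω) = i → X ω = Y i ω)
    (hTZ : ∀ i ω, C (X ω) = i → T ω = m (Y i ω) + Z i ω) (hind : ∀ i, IndepFun (Z i) (Y i) P)
    (hlaw : ∀ i, P.map (Z i) = gaussianReal 0 (v i).toNNReal) :
    P.map (fun ω => (X ω, T ω)) = condNormal (P.map X) m (fun h => v (C h)) := by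
  have hv : Measurable v := measurable_of_countable v
  have hcase : ∀ i, MeasurableSet (C ⁻¹' {i}) := fun i => hC (measurableSet_singleton i)
  have hcover : ⋃ i, Prod.fst ⁻¹' (C ⁻¹' {i}) = (Set.univ : Set (H × ℝ)) := by
    ext q
    simp
  refine (Measure.ext_iff_of_iUnion_eq_univ hcover).2 fun i => ?_
  have hpre : X ⁻¹' (C ⁻¹' {i}) = Y i ⁻¹' (C ⁻¹' {i}) := Set.ext (hiff i)
  calc (P.map fun ω => (X ω, T ω)).restrict (Prod.fst ⁻¹' (C ⁻¹' {i}))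
      = (P.map fun ω => (Y i ω, m (Y i ω) + Z i ω)).restrict (Prod.fst ⁻¹' (C ⁻¹' {i})) :=
        restrict_map_congr (by fun_prop) (by fun_prop) (measurable_fst (hcase i)) hpre
          fun ω hω => Prod.ext (hXY i ω hω) (hTZ i ω hω)
    _ = condNormal ((P.map (Y i)).restrict (C ⁻¹' {i})) m fun _ => v i := by
        rw [map_prodMk_add_eq_condNormal (hY i) (hZ i) hm (hind i) (hlaw i),
          restrict_condNormal hm measurable_const (hcase i)]
    _ = condNormal ((P.map X).restrict (C ⁻¹' {i})) m fun h => v (C h) := by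
        rw [restrict_map_congr hX (hY i) (hcase i) hpre (hXY i)]
        refine condNormal_congr ((ae_restrict_iff' (hcase i)).2 (.of_forall fun h hh => ?_))
        exact congrArg v (Eq.symm hh)
    _ = (condNormal (P.map X) m fun h => v (C h)).restrict (Prod.fst ⁻¹' (C ⁻¹' {i})) :=
        (restrict_condNormal hm (hv.comp hC) (hcase i)).symm

end CondNormal

open scoped unitInterval

section Sequences

lemma comp_castLE_of_init {D : Type*} {h : (t : ℕ) → Fin t → D}
    (hinit : ∀ t, Fin.init (α := fun _ => D) (h (t + 1)) = h t) {r t : ℕ} (hrt : r ≤ t) :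
    (fun i => h t (Fin.castLE hrt i)) = h r := by
  induction t, hrt using Nat.le_induction with
  | base => rfl
  | succ t hrt ih =>
    rw [← ih]
    ext i : 1
    exact congrFun (hinit t) (Fin.castLE hrt i)

variable {Ω Ω' A B D : Type*} [MeasurableSpace Ω] [MeasurableSpace Ω'] [MeasurableSpace A]
  [MeasurableSpace B] [MeasurableSpace D]

@[fun_prop]
lemma measurable_finSnoc (t : ℕ) :
    Measurable fun q : (Fin t → D) × D =>
      (Fin.snoc (α := fun _ => D) q.1 q.2 : Fin (t + 1) → D) := by
  refine measurable_pi_iff.2 fun r => Fin.lastCases ?_ (fun r => ?_) r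
  · simpa using measurable_snd
  · simp only [Fin.snoc_castSucc]
    fun_prop

@[fun_prop]
lemma measurable_finInit (t : ℕ) :
    Measurable fun h : Fin (t + 1) → D => (Fin.init (α := fun _ => D) h : Fin t → D) := by
  unfold Fin.init
  fun_prop

lemma measurePreserving_init_last (t : ℕ) :
    MeasurePreserving (fun u : Fin (t + 1) → I => (Fin.init (α := fun _ => I) u, u (Fin.last t)))
      volume (volume.prod volume) := by
  have h := Measure.measurePreserving_swap.comp
    (volume_preserving_piFinSuccAbove (fun _ : Fin (t + 1) => I) (Fin.last t))
  have heq : (fun u : Fin (t + 1) → I => (Fin.init (α := fun _ => I) u, u (Fin.last t))) =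
      Prod.swap ∘ MeasurableEquiv.piFinSuccAbove (fun _ => I) (Fin.last t) := by
    ext u : 2
    · simp
    · rfl
  exact heq ▸ h

lemma measurePreserving_prod_init_last (P : Measure Ω) [SFinite P] (t : ℕ) :
    MeasurePreserving (fun p : Ω × (Fin (t + 1) → I) =>
        ((p.1, Fin.init (α := fun _ => I) p.2), p.2 (Fin.last t)))
      (P.prod volume) ((P.prod volume).prod volume) :=
  (measurePreserving_prodAssoc P volume volume).symm.comp
    ((MeasurePreserving.id P).prod (measurePreserving_init_last t))

lemma measurePreserving_infinitePi_restrict_fin (t : ℕ) :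
    MeasurePreserving (fun (u : ℕ → I) (r : Fin t) => u r)
      (Measure.infinitePi fun _ => (volume : Measure I)) volume := by
  refine ⟨by fun_prop, ?_⟩
  have hindep := (iIndepFun_infinitePi (P := fun _ : ℕ => (volume : Measure I))
    (X := fun _ x => x) fun _ => measurable_id).precomp (Fin.val_injective (n := t))
  rw [(iIndepFun_iff_map_fun_eq_pi_map
    fun r => (measurable_pi_apply _).aemeasurable).1 hindep, volume_pi]
  congr 1
  ext r : 1
  exact Measure.infinitePi_map_eval _ _

variable {P : Measure Ω} {Q : Measure Ω'}

lemma map_pi_prodMk_eq_of_init [IsProbabilityMeasure P] {X : (t : ℕ) → Ω → Fin t → D}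
    {Y : (t : ℕ) → Ω' → Fin t → D}
    {T : Ω → B} {T' : Ω' → B} (hX : ∀ t, Measurable (X t)) (hY : ∀ t, Measurable (Y t))
    (hT : Measurable T) (hT' : Measurable T')
    (hX_init : ∀ t ω, Fin.init (α := fun _ => D) (X (t + 1) ω) = X t ω)
    (hY_init : ∀ t ω, Fin.init (α := fun _ => D) (Y (t + 1) ω) = Y t ω)
    (h : ∀ t, P.map (fun ω => (X t ω, T ω)) = Q.map fun ω => (Y t ω, T' ω)) :
    P.map (fun ω => ((fun t => X t ω), T ω)) = Q.map fun ω => ((fun t => Y t ω), T' ω) := by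
  have hseq : P.map (fun ω t => (X t ω, T ω)) = Q.map fun ω t => (Y t ω, T' ω) := by
    have hP := isProjectiveLimit_map (P := P) (X := fun t ω => (X t ω, T ω)) (by fun_prop)
    have hQ := isProjectiveLimit_map (P := Q) (X := fun t ω => (Y t ω, T' ω)) (by fun_prop)
    refine hP.unique ?_
    convert hQ using 2 with J
    have hJ : ∀ r : J, (r : ℕ) ≤ J.sup id := fun r => Finset.le_sup (f := id) r.2
    have hrestrict := congrArg (Measure.map fun q : (Fin (J.sup id) → D) × B =>
      fun r : J => ((fun i : Fin r => q.1 (Fin.castLE (hJ r) i)), q.2)) (h _)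
    rw [Measure.map_map (by fun_prop) (by fun_prop),
      Measure.map_map (by fun_prop) (by fun_prop)] at hrestrict
    simp only [Function.comp_def, comp_castLE_of_init (h := fun t => X t _) fun t => hX_init t _,
      comp_castLE_of_init (h := fun t => Y t _) fun t => hY_init t _] at hrestrict
    exact hrestrict
  have hmap := congrArg (Measure.map fun z : (t : ℕ) → (Fin t → D) × B =>
    ((fun t => (z t).1), (z 0).2)) hseq
  rwa [Measure.map_map (by fun_prop) (by fun_prop),
    Measure.map_map (by fun_prop) (by fun_prop)] at hmap

lemma exists_integral_le_of_map_prod_eq [SFinite Q] {ν : Measure B}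
    [IsProbabilityMeasure ν] {X : Ω → A} {Y : Ω' × B → A} (hX : Measurable X) (hY : Measurable Y)
    (h : (Q.prod ν).map Y = P.map X) {Φ : A → ℝ} (hΦ : Measurable Φ)
    (hint : Integrable (fun ω => Φ (X ω)) P) :
    ∃ b, Integrable (fun ω => Φ (Y (ω, b))) Q ∧ ∫ ω, Φ (X ω) ∂P ≤ ∫ ω, Φ (Y (ω, b)) ∂Q := by
  have hint' : Integrable (fun p => Φ (Y p)) (Q.prod ν) := by
    have hlaw := (integrable_map_measure hΦ.aestronglyMeasurable hX.aemeasurable).2 hint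
    rw [← h] at hlaw
    exact (integrable_map_measure hΦ.aestronglyMeasurable hY.aemeasurable).1 hlaw
  have hmean : ∫ ω, Φ (X ω) ∂P = ∫ b, ∫ ω, Φ (Y (ω, b)) ∂Q ∂ν := by
    rw [← integral_prod_symm _ hint', ← integral_map hX.aemeasurable hΦ.aestronglyMeasurable, ← h,
      integral_map hY.aemeasurable hΦ.aestronglyMeasurable]
  obtain ⟨b, hb, hle⟩ := exists_notMem_null_integral_le hint'.integral_prod_right
    (measure_eq_zero_iff_ae_notMem.2 (hint'.prod_left_ae.mono fun b hb => not_not.2 hb))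
  exact ⟨b, not_not.1 hb, hmean.trans_le hle⟩

variable [IsProbabilityMeasure P]

lemma exists_measurable_map_eq_of_condDistrib [StandardBorelSpace D] [Nonempty D] {X : Ω → A}
    {V : Ω → D} (hX : Measurable X) (hV : Measurable V) :
    ∃ F : A → I → D, Measurable (Function.uncurry F) ∧
      ((P.map X).prod (volume : Measure I)).map (fun q => (q.1, F q.1 q.2)) =
        P.map fun ω => (X ω, V ω) := by
  obtain ⟨F, hF, h⟩ := (condDistrib V X P).exists_measurable_map_eq_unitInterval
  refine ⟨F, hF, ?_⟩
  have : IsProbabilityMeasure (P.map X) := Measure.isProbabilityMeasure_map hX.aemeasurable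
  have hF' : Measurable fun q : A × I => F q.1 q.2 := hF
  rw [← compProd_map_condDistrib hV.aemeasurable]
  refine Measure.ext_of_lintegral _ fun g hg => ?_
  rw [lintegral_map hg (by fun_prop), lintegral_prod _ (by fun_prop),
    Measure.lintegral_compProd hg]
  refine lintegral_congr fun a => ?_
  rw [← h, lintegral_map (by fun_prop) hF.of_uncurry_left]

lemma map_prodMk_of_map_eq_prod {Q : Measure B} [IsProbabilityMeasure Q] {X : Ω → A} {e : Ω → D}
    {ρ : Measure D} [SFinite ρ] (hX : Measurable X) (he : Measurable e)
    (h : P.map (fun ω => (X ω, e ω)) = (P.map X).prod ρ) {H : Type*} [MeasurableSpace H]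
    {φ : A × B → H} (hφ : Measurable φ) :
    (P.prod Q).map (fun p => (φ (X p.1, p.2), e p.1)) =
      ((P.prod Q).map fun p => φ (X p.1, p.2)).prod ρ := by
  refine Measure.ext_of_lintegral _ fun g hg => ?_
  have hin : Measurable fun q : A × D => ∫⁻ b, g (φ (q.1, b), q.2) ∂Q :=
    Measurable.lintegral_prod_right' (f := fun q : (A × D) × B => g (φ (q.1.1, q.2), q.1.2))
      (by fun_prop)
  have hout : Measurable fun x => ∫⁻ b, ∫⁻ d, g (φ (x, b), d) ∂ρ ∂Q :=
    Measurable.lintegral_prod_right' (f := fun q : A × B => ∫⁻ d, g (φ q, d) ∂ρ) (by fun_prop)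
  have hφg : Measurable fun x : H => ∫⁻ d, g (x, d) ∂ρ := hg.lintegral_prod_right'
  calc ∫⁻ q, g q ∂((P.prod Q).map fun p => (φ (X p.1, p.2), e p.1))
      = ∫⁻ ω, ∫⁻ b, g (φ (X ω, b), e ω) ∂Q ∂P := by
        rw [lintegral_map hg (by fun_prop), lintegral_prod _ (by fun_prop)]
    _ = ∫⁻ x, ∫⁻ d, ∫⁻ b, g (φ (x, b), d) ∂Q ∂ρ ∂(P.map X) := by
        rw [← lintegral_prod _ hin.aemeasurable, ← h, lintegral_map hin (by fun_prop)]
    _ = ∫⁻ x, ∫⁻ b, ∫⁻ d, g (φ (x, b), d) ∂ρ ∂Q ∂(P.map X) :=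
        lintegral_congr fun x => lintegral_lintegral_swap (by fun_prop)
    _ = _ := by
        rw [lintegral_map hout hX, lintegral_prod _ hg.aemeasurable,
          lintegral_map hφg (by fun_prop), lintegral_prod _ (by fun_prop)]

end Sequences

section Learning

variable {D D' : Type*}

/-- A history simulated from an actual history with statistics `y` and from the randomization `u`:
the kernel `F t`, driven by a uniform variable, draws the signal of period `t`. -/
def simulate (y : (t : ℕ) → (Fin t → D') → ℝ) (F : (t : ℕ) → (Fin t → D) × ℝ → I → D) :
    (t : ℕ) → (Fin t → D') → (Fin t → I) → Fin t → D
  | 0, _, _ => Fin.elim0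
  | t + 1, h, u => Fin.snoc (α := fun _ => D)
      (simulate y F t (Fin.init (α := fun _ => D') h) (Fin.init (α := fun _ => I) u))
      (F t (simulate y F t (Fin.init (α := fun _ => D') h) (Fin.init (α := fun _ => I) u),
        y (t + 1) h) (u (Fin.last t)))

lemma init_simulate {y : (t : ℕ) → (Fin t → D') → ℝ} {F : (t : ℕ) → (Fin t → D) × ℝ → I → D}
    (t : ℕ) (h : Fin (t + 1) → D') (u : Fin (t + 1) → I) :
    Fin.init (α := fun _ => D) (simulate y F (t + 1) h u) =
      simulate y F t (Fin.init (α := fun _ => D') h) (Fin.init (α := fun _ => I) u) := by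
  rw [simulate, Fin.init_snoc]

variable {Ω Ω' : Type*} [MeasurableSpace Ω] [MeasurableSpace Ω'] [MeasurableSpace D]
  [MeasurableSpace D']

/-- The histories `H t`, of length `t`, reveal the real variable `T` in a conditionally Gaussian
way: given `H t`, the variable `T` is normal with mean `m t` and variance `w t`, and the next
conditional mean is normal with mean `m t`; the next conditional variance `n t` is already known
at `H t`. -/
structure IsGaussianLearning (P : Measure Ω) (H : (t : ℕ) → Ω → Fin t → D) (T : Ω → ℝ)
    (m w n : (t : ℕ) → (Fin t → D) → ℝ) : Prop where
  measurable_history : ∀ t, Measurable (H t)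
  measurable_state : Measurable T
  measurable_mean : ∀ t, Measurable (m t)
  measurable_var : ∀ t, Measurable (w t)
  measurable_nextVar : ∀ t, Measurable (n t)
  init_history : ∀ t ω, Fin.init (α := fun _ => D) (H (t + 1) ω) = H t ω
  var_history_succ : ∀ t ω, w (t + 1) (H (t + 1) ω) = n t (H t ω)
  nextVar_nonneg : ∀ t h, 0 ≤ n t h
  nextVar_le_var : ∀ t h, n t h ≤ w t h
  map_state : ∀ t, P.map (fun ω => (H t ω, T ω)) = condNormal (P.map (H t)) (m t) (w t)
  map_nextMean : ∀ t, P.map (fun ω => (H t ω, m (t + 1) (H (t + 1) ω))) =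
    condNormal (P.map (H t)) (m t) fun h => w t h - n t h

/-- The conditional mean after `t` periods plus noise that raises the residual variance `v t` to
the conditional variance: a coarser signal about the state than the history itself. -/
def noisyMean (H : (t : ℕ) → Ω → Fin t → D) (m w : (t : ℕ) → (Fin t → D) → ℝ) (v : ℕ → ℝ) (t : ℕ)
    (p : Ω × ℝ) : ℝ :=
  m t (H t p.1) + √(w t (H t p.1) - v t) * p.2

lemma measurable_simulate {y : (t : ℕ) → (Fin t → D') → ℝ}
    {F : (t : ℕ) → (Fin t → D) × ℝ → I → D}
    (hy : ∀ t, Measurable (y t))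
    (hF : ∀ t, Measurable (Function.uncurry (F t))) (t : ℕ) :
    Measurable fun q : (Fin t → D') × (Fin t → I) => simulate y F t q.1 q.2 := by
  induction t with
  | zero => exact measurable_const
  | succ t ih =>
    have hy' := hy (t + 1)
    have hF' : Measurable fun q : ((Fin t → D) × ℝ) × I => F t q.1 q.2 := hF t
    have hsim : Measurable fun q : (Fin (t + 1) → D') × (Fin (t + 1) → I) =>
        simulate y F t (Fin.init (α := fun _ => D') q.1) (Fin.init (α := fun _ => I) q.2) :=
      ih.comp (f := fun q : (Fin (t + 1) → D') × (Fin (t + 1) → I) =>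
        (Fin.init (α := fun _ => D') q.1, Fin.init (α := fun _ => I) q.2)) (by fun_prop)
    exact (measurable_finSnoc t).comp (hsim.prodMk (hF'.comp
      ((hsim.prodMk (by fun_prop)).prodMk (by fun_prop : Measurable fun q :
        (Fin (t + 1) → D') × (Fin (t + 1) → I) => q.2 (Fin.last t)))))

namespace IsGaussianLearning

variable {P : Measure Ω} {H : (t : ℕ) → Ω → Fin t → D} {T : Ω → ℝ}
  {m w n : (t : ℕ) → (Fin t → D) → ℝ} (h : IsGaussianLearning P H T m w n) {v : ℕ → ℝ}

include h

@[fun_prop]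
lemma measurable_noisyMean (t : ℕ) : Measurable (noisyMean H m w v t) := by
  have := h.measurable_history t
  have := h.measurable_mean t
  have := h.measurable_var t
  unfold noisyMean
  fun_prop

variable [IsProbabilityMeasure P]

lemma map_history_noisyMean (t : ℕ) :
    (P.prod (gaussianReal 0 1)).map (fun p => (H t p.1, noisyMean H m w v t p)) =
      condNormal (P.map (H t)) (m t) fun x => w t x - v t :=
  map_prod_gaussianReal_eq_condNormal (h.measurable_history t) (h.measurable_mean t)
    ((h.measurable_var t).sub_const _)

lemma map_history_noisyMean_succ (hv : ∀ t x, v (t + 1) ≤ n t x) (t : ℕ) :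
    (P.prod (gaussianReal 0 1)).map (fun p => (H t p.1, noisyMean H m w v (t + 1) p)) =
      condNormal (P.map (H t)) (m t) fun x => w t x - v (t + 1) := by
  have hH := h.measurable_history
  have hm := h.measurable_mean
  have hw := h.measurable_var t
  have hn := h.measurable_nextVar t
  have : Measurable fun ω => m (t + 1) (H (t + 1) ω) := (hm _).comp (hH _)
  have hadd := map_condNormal_prod_gaussianReal (ν := P.map (H t)) (w := fun x => w t x - n t x)
    (w' := fun x => n t x - v (t + 1)) (hm t) (by fun_prop) (by fun_prop)
    (fun x => sub_nonneg.2 (h.nextVar_le_var t x)) fun x => sub_nonneg.2 (hv t x)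
  rw [← h.map_nextMean, ← Measure.map_id (μ := gaussianReal 0 1),
    Measure.map_prod_map _ _ (by fun_prop) measurable_id,
    Measure.map_map (by fun_prop) (by fun_prop)] at hadd
  simp only [sub_add_sub_cancel] at hadd
  rw [← hadd]
  congr 1
  ext p : 1
  rw [noisyMean, h.var_history_succ]
  rfl

lemma exists_draw [StandardBorelSpace D] [Nonempty D] (hv : ∀ t x, v (t + 1) ≤ n t x) (t : ℕ) :
    ∃ F : (Fin t → D) × ℝ → I → D, Measurable (Function.uncurry F) ∧
      ((condNormal (P.map (H t)) (m t) fun x => w t x - v (t + 1)).prod volume).map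
        (fun q => ((Fin.snoc (α := fun _ => D) q.1.1 (F q.1 q.2) : Fin (t + 1) → D), q.1.2)) =
      condNormal (P.map (H (t + 1))) (m (t + 1)) fun x => w (t + 1) x - v (t + 1) := by
  have hH := h.measurable_history
  have := h.measurable_noisyMean (v := v) (t + 1)
  have hV : Measurable fun p : Ω × ℝ => H (t + 1) p.1 (Fin.last t) := by fun_prop
  obtain ⟨F, hF, hlaw⟩ := exists_measurable_map_eq_of_condDistrib (P := P.prod (gaussianReal 0 1))
    (X := fun p => (H t p.1, noisyMean H m w v (t + 1) p)) (by fun_prop) hV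
  have hF' : Measurable fun q : ((Fin t → D) × ℝ) × I => F q.1 q.2 := hF
  refine ⟨F, hF, ?_⟩
  have hmap := congrArg (Measure.map fun q : ((Fin t → D) × ℝ) × D =>
    ((Fin.snoc (α := fun _ => D) q.1.1 q.2 : Fin (t + 1) → D), q.1.2)) hlaw
  rw [h.map_history_noisyMean_succ hv, Measure.map_map (by fun_prop) (by fun_prop),
    Measure.map_map (by fun_prop) (by fun_prop)] at hmap
  rw [← h.map_history_noisyMean]
  refine hmap.trans ?_
  congr 1
  ext p : 1
  rw [Function.comp_apply, ← h.init_history, Fin.snoc_init_self]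

variable {P' : Measure Ω'} [IsProbabilityMeasure P'] {H' : (t : ℕ) → Ω' → Fin t → D'} {T' : Ω' → ℝ}
  {m' : (t : ℕ) → (Fin t → D') → ℝ}
  (h' : IsGaussianLearning P' H' T' m' (fun t _ => v t) fun t _ => v (t + 1))
  {F : (t : ℕ) → (Fin t → D) × ℝ → I → D}

include h'

lemma map_simulate_add (hF : ∀ t, Measurable (Function.uncurry (F t))) {t : ℕ}
    (hv : ∀ x, v t ≤ w t x) (hsim : (P'.prod volume).map
      (fun p => (simulate m' F t (H' t p.1) p.2, m' t (H' t p.1))) =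
        condNormal (P.map (H t)) (m t) fun x => w t x - v t)
    {e : Ω' → ℝ} (he : Measurable e) {a : ℝ} (ha : 0 ≤ a)
    (hlaw : P'.map (fun ω => (H' t ω, e ω)) =
      (P'.map (H' t)).prod (gaussianReal 0 a.toNNReal)) :
    (P'.prod volume).map
        (fun p => (simulate m' F t (H' t p.1) p.2, m' t (H' t p.1) + e p.1)) =
      condNormal (P.map (H t)) (m t) fun x => w t x - v t + a := by
  have hH' := h'.measurable_history t
  have hm' := h'.measurable_mean t
  have hw := h.measurable_var t
  have : IsProbabilityMeasure (P.map (H t)) :=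
    Measure.isProbabilityMeasure_map (h.measurable_history t).aemeasurable
  have hφ : Measurable fun q : (Fin t → D') × (Fin t → I) => (simulate m' F t q.1 q.2, m' t q.1) :=
    (measurable_simulate h'.measurable_mean hF t).prodMk (by fun_prop)
  have hpair := map_prodMk_of_map_eq_prod (P := P') (Q := volume) hH' he hlaw hφ
  have hmeas : Measurable fun p : Ω' × (Fin t → I) =>
      ((simulate m' F t (H' t p.1) p.2, m' t (H' t p.1)), e p.1) :=
    (hφ.comp (f := fun p : Ω' × (Fin t → I) => (H' t p.1, p.2)) (by fun_prop)).prodMk (by fun_prop)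
  rw [← map_condNormal_prod_gaussianReal_toNNReal (h.measurable_mean t) (by fun_prop)
    (fun x => sub_nonneg.2 (hv x)) ha, ← hsim, ← hpair, Measure.map_map (by fun_prop) hmeas]
  rfl

lemma map_simulate_mean (hF : ∀ t, Measurable (Function.uncurry (F t)))
    (hdraw : ∀ t, ((condNormal (P.map (H t)) (m t) fun x => w t x - v (t + 1)).prod volume).map
        (fun q => ((Fin.snoc (α := fun _ => D) q.1.1 (F t q.1 q.2) : Fin (t + 1) → D), q.1.2)) =
      condNormal (P.map (H (t + 1))) (m (t + 1)) fun x => w (t + 1) x - v (t + 1))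
    (hm₀ : m 0 Fin.elim0 = m' 0 Fin.elim0) (hw₀ : w 0 Fin.elim0 = v 0)
    (hv : ∀ t x, v t ≤ w t x) (t : ℕ) :
    (P'.prod volume).map (fun p => (simulate m' F t (H' t p.1) p.2, m' t (H' t p.1))) =
      condNormal (P.map (H t)) (m t) fun x => w t x - v t := by
  induction t with
  | zero =>
    rw [← map_prod_gaussianReal_eq_condNormal (h.measurable_history 0) (h.measurable_mean 0)
      ((h.measurable_var 0).sub_const _)]
    have hleft : (fun p : Ω' × (Fin 0 → I) => (simulate m' F 0 (H' 0 p.1) p.2, m' 0 (H' 0 p.1))) =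
        fun _ => ((Fin.elim0 : Fin 0 → D), m 0 Fin.elim0) := by
      funext p
      rw [hm₀, Subsingleton.elim (H' 0 p.1) Fin.elim0, simulate]
    have hright : (fun p : Ω × ℝ => (H 0 p.1, m 0 (H 0 p.1) + √(w 0 (H 0 p.1) - v 0) * p.2)) =
        fun _ => ((Fin.elim0 : Fin 0 → D), m 0 Fin.elim0) := by
      funext p
      rw [Subsingleton.elim (H 0 p.1) Fin.elim0, hw₀, sub_self, Real.sqrt_zero, zero_mul, add_zero]
    rw [hleft, hright, Measure.map_const, Measure.map_const, measure_univ, measure_univ]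
  | succ t ih =>
    have hH' := h'.measurable_history
    have hm' := h'.measurable_mean
    have hF' : Measurable fun q : ((Fin t → D) × ℝ) × I => F t q.1 q.2 := hF t
    obtain ⟨ω⟩ := P'.nonempty_of_neZero
    have hnext : Measurable fun ω => m' (t + 1) (H' (t + 1) ω) := (hm' _).comp (hH' _)
    have hlaw := map_prodMk_sub_eq_prod (hH' t) hnext (hm' t) (h'.map_nextMean t)
    have hadd := map_simulate_add h h' hF (hv t) ih (by fun_prop)
      (sub_nonneg.2 (h'.nextVar_le_var t (H' t ω))) hlaw
    simp only [sub_add_sub_cancel, add_sub_cancel] at hadd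
    have hsim : MeasurePreserving (fun p : Ω' × (Fin t → I) =>
        (simulate m' F t (H' t p.1) p.2, m' (t + 1) (H' (t + 1) p.1))) (P'.prod volume)
        (condNormal (P.map (H t)) (m t) fun x => w t x - v (t + 1)) :=
      ⟨((measurable_simulate hm' hF t).comp (f := fun p : Ω' × (Fin t → I) => (H' t p.1, p.2))
        (by fun_prop)).prodMk (by fun_prop), hadd⟩
    have hsnoc : MeasurePreserving _ _ _ := ⟨by fun_prop, hdraw t⟩
    have hcomp := (hsnoc.comp ((hsim.prod (.id volume)).comp
      (measurePreserving_prod_init_last P' t))).map_eq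
    rw [← hcomp]
    congr 1
    ext p : 1
    rw [simulate, h'.init_history]
    rfl

theorem exists_simulation [StandardBorelSpace D] [Nonempty D]
    (hm₀ : m 0 Fin.elim0 = m' 0 Fin.elim0) (hw₀ : w 0 Fin.elim0 = v 0) (hv : ∀ t x, v t ≤ w t x)
    (hv' : ∀ t x, v (t + 1) ≤ n t x) :
    ∃ G : (t : ℕ) → (Fin t → D') → (Fin t → I) → Fin t → D,
      (∀ t, Measurable fun q : (Fin t → D') × (Fin t → I) => G t q.1 q.2) ∧
      (∀ t x u, Fin.init (α := fun _ => D) (G (t + 1) x u) =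
        G t (Fin.init (α := fun _ => D') x) (Fin.init (α := fun _ => I) u)) ∧
      ∀ t, (P'.prod volume).map (fun p => (G t (H' t p.1) p.2, T' p.1)) =
        P.map fun ω => (H t ω, T ω) := by
  choose F hF hdraw using h.exists_draw hv'
  refine ⟨simulate m' F, measurable_simulate h'.measurable_mean hF, init_simulate, fun t => ?_⟩
  have hT' := h'.measurable_state
  have := h'.measurable_history t
  have := h'.measurable_mean t
  obtain ⟨ω⟩ := P'.nonempty_of_neZero
  have hstate := map_prodMk_sub_eq_prod (h'.measurable_history t) hT' (h'.measurable_mean t)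
    (h'.map_state t)
  have hadd := map_simulate_add h h' hF (hv t) (map_simulate_mean h h' hF hdraw hm₀ hw₀ hv t)
    (by fun_prop) ((h'.nextVar_nonneg t (H' t ω)).trans (h'.nextVar_le_var t (H' t ω))) hstate
  simp only [sub_add_cancel, add_sub_cancel] at hadd
  rw [hadd, h.map_state]

theorem exists_integral_le [StandardBorelSpace D] [Nonempty D]
    (hm₀ : m 0 Fin.elim0 = m' 0 Fin.elim0) (hw₀ : w 0 Fin.elim0 = v 0) (hv : ∀ t x, v t ≤ w t x)
    (hv' : ∀ t x, v (t + 1) ≤ n t x) {Φ : ((t : ℕ) → Fin t → D) × ℝ → ℝ} (hΦ : Measurable Φ)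
    (hint : Integrable (fun ω => Φ (fun t => H t ω, T ω)) P) :
    ∃ G : (t : ℕ) → (Fin t → D') → Fin t → D, (∀ t, Measurable (G t)) ∧
      Integrable (fun ω => Φ (fun t => G t (H' t ω), T' ω)) P' ∧
      ∫ ω, Φ (fun t => H t ω, T ω) ∂P ≤ ∫ ω, Φ (fun t => G t (H' t ω), T' ω) ∂P' := by
  obtain ⟨G, hG, hG_init, hG_map⟩ := h.exists_simulation h' hm₀ hw₀ hv hv'
  have hH := h.measurable_history
  have hT := h.measurable_state
  have hH' := h'.measurable_history
  have hT' := h'.measurable_state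
  have hsim : ∀ t, Measurable fun p : Ω' × (ℕ → I) => G t (H' t p.1) fun r => p.2 r.1 := fun t =>
    (hG t).comp (f := fun p : Ω' × (ℕ → I) => (H' t p.1, fun r : Fin t => p.2 r)) (by fun_prop)
  have hlaw : (P'.prod (Measure.infinitePi fun _ => (volume : Measure I))).map
      (fun p => ((fun t => G t (H' t p.1) fun r => p.2 r.1), T' p.1)) =
        P.map fun ω => ((fun t => H t ω), T ω) := by
    refine map_pi_prodMk_eq_of_init hsim hH (by fun_prop) hT (fun t p => ?_) h.init_history
      fun t => ?_
    · rw [hG_init, h'.init_history]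
      rfl
    · have hGt := hG t
      rw [← hG_map t, ← ((MeasurePreserving.id P').prod
        (measurePreserving_infinitePi_restrict_fin t)).map_eq,
        Measure.map_map _ (by fun_prop)]
      · rfl
      · exact (hGt.comp (f := fun p : Ω' × (Fin t → I) => (H' t p.1, p.2)) (by fun_prop)).prodMk
          (by fun_prop)
  obtain ⟨u, hu, hle⟩ := exists_integral_le_of_map_prod_eq
    (X := fun ω => ((fun t => H t ω), T ω)) (by fun_prop) (by fun_prop) hlaw hΦ hint
  exact ⟨fun t x => G t x fun r => u r.1, fun t => (hG t).comp measurable_prodMk_right, hu, hle⟩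

end IsGaussianLearning

end Learning

section Choices

variable {K B t : ℕ}

/-- The sources observed along a history, period by period. -/
def InfoStrategy.chosen (S : InfoStrategy K B) (h : History B t) (p : Fin t × Fin B) : Fin K :=
  S.choose p.1 (fun r : Fin p.1 => h (Fin.castLE p.1.isLt.le r)) p.2

lemma InfoStrategy.measurable_chosen (S : InfoStrategy K B) (t : ℕ) :
    Measurable fun h : History B t => S.chosen h :=
  measurable_pi_iff.2 fun p =>
    (measurable_pi_apply p.2).comp ((S.measurable_choose p.1).comp (by fun_prop))

lemma InfoStrategy.count_chosen (S : InfoStrategy K B) (h : History B t) :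
    Environment.count (S.chosen h) = S.division h := by
  ext k
  simp only [Environment.count, InfoStrategy.division, tally, Finset.card_filter, Finset.sum_apply]
  rw [Fintype.sum_prod_type]
  rfl

/-- The sources of `t + 1` periods, from those of the first `t` and those of the last. -/
def extendChoice (κ : Fin t × Fin B → Fin K) (c : Fin B → Fin K) (p : Fin (t + 1) × Fin B) :
    Fin K :=
  Fin.lastCases (motive := fun _ => Fin K) (c p.2) (fun r => κ (r, p.2)) p.1

lemma count_extendChoice (κ : Fin t × Fin B → Fin K) (c : Fin B → Fin K) :
    Environment.count (extendChoice κ c) = Environment.count κ + tally c := by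
  ext k
  simp only [Environment.count, tally, Pi.add_apply, Finset.card_filter]
  rw [Fintype.sum_prod_type, Fintype.sum_prod_type, Fin.sum_univ_castSucc]
  simp [extendChoice]

/-- The realization numbers and sources of the observations made when the sources `κ` are chosen;
the numbering is that of `Environment.hist`. -/
def slot (κ : Fin t × Fin B → Fin K) (p : Fin t × Fin B) : ℕ × Fin K :=
  (p.1 * B + p.2, κ p)

lemma slot_injective (κ : Fin t × Fin B → Fin K) : Function.Injective (slot κ) := by
  rintro ⟨r, b⟩ ⟨r', b'⟩ h
  have hnum : (r : ℕ) * B + b = r' * B + b' := congrArg Prod.fst h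
  have hfin : finProdFinEquiv (r, b) = finProdFinEquiv (r', b') := by
    ext
    simpa [mul_comm B, add_comm] using hnum
  exact finProdFinEquiv.injective hfin

lemma range_slot_subset_range_slot_extendChoice (κ : Fin t × Fin B → Fin K) (c : Fin B → Fin K) :
    Set.range (slot κ) ⊆ Set.range (slot (extendChoice κ c)) := by
  rintro _ ⟨p, rfl⟩
  exact ⟨(p.1.castSucc, p.2), by simp [slot, extendChoice]⟩

end Choices

namespace Environment

variable {K B : ℕ} (E : Environment K)

/-- The history of the first `t` periods when the sources `κ` are chosen. -/
def histAlong {t : ℕ} (κ : Fin t × Fin B → Fin K) (ω : Sample K) : History B t :=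
  Function.curry (E.obs (slot κ) ω)

@[fun_prop]
lemma measurable_histAlong {t : ℕ} (κ : Fin t × Fin B → Fin K) : Measurable (E.histAlong κ) := by
  unfold histAlong Function.curry
  fun_prop

variable {E} in
lemma indepFun_histAlong {Z : Sample K → ℝ} {t : ℕ} {κ : Fin t × Fin B → Fin K}
    (h : IndepFun Z (E.obs (slot κ)) E.P) : IndepFun Z (E.histAlong κ) E.P :=
  h.comp (φ := id) (ψ := Function.curry) measurable_id (by unfold Function.curry; fun_prop)

variable (S : InfoStrategy K B)

lemma init_hist (ω : Sample K) (t : ℕ) :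
    Fin.init (α := fun _ => Fin B → ℝ) (E.hist S ω (t + 1)) = E.hist S ω t := by
  rw [hist, Fin.init_snoc]

lemma hist_castLE (ω : Sample K) {r t : ℕ} (hrt : r ≤ t) :
    (fun i : Fin r => E.hist S ω t (Fin.castLE hrt i)) = E.hist S ω r :=
  comp_castLE_of_init (h := E.hist S ω) (E.init_hist S ω) hrt

lemma hist_apply (ω : Sample K) {t : ℕ} (r : Fin t) (b : Fin B) :
    E.hist S ω t r b = E.signal (r * B + b) (S.choose r (E.hist S ω r) b) ω := by
  have hlast : E.hist S ω (r + 1) (Fin.last r) b =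
      E.signal (r * B + b) (S.choose r (E.hist S ω r) b) ω := by
    rw [hist, Fin.snoc_last]
  rw [← hlast, ← E.hist_castLE S ω (Nat.succ_le_of_lt r.isLt)]
  rfl

lemma chosen_hist (ω : Sample K) (t : ℕ) (p : Fin t × Fin B) :
    S.chosen (E.hist S ω t) p = S.choose p.1 (E.hist S ω p.1) p.2 := by
  rw [InfoStrategy.chosen, hist_castLE]

lemma chosen_hist_succ (ω : Sample K) (t : ℕ) : S.chosen (E.hist S ω (t + 1)) =
    extendChoice (S.chosen (E.hist S ω t)) (S.choose t (E.hist S ω t)) := by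
  ext ⟨r, b⟩ : 1
  rw [chosen_hist]
  refine Fin.lastCases ?_ (fun r => ?_) r
  · simp [extendChoice]
  · simp [extendChoice, chosen_hist]

lemma histAlong_chosen_hist (ω : Sample K) (t : ℕ) :
    E.histAlong (S.chosen (E.hist S ω t)) ω = E.hist S ω t := by
  ext r b
  rw [hist_apply, histAlong, Function.curry_apply, obs, slot, chosen_hist]

lemma obs_slot_chosen_hist (ω : Sample K) (t : ℕ) :
    E.obs (slot (S.chosen (E.hist S ω t))) ω = Function.uncurry (E.hist S ω t) := by
  conv_rhs => rw [← E.histAlong_chosen_hist, histAlong, Function.uncurry_curry]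

variable {S}

lemma hist_eq_histAlong {ω : Sample K} {t : ℕ} {κ : Fin t × Fin B → Fin K}
    (h : S.chosen (E.histAlong κ ω) = κ) : E.hist S ω t = E.histAlong κ ω := by
  have happly : ∀ (r : ℕ) (hr : r < t), E.hist S ω t ⟨r, hr⟩ = E.histAlong κ ω ⟨r, hr⟩ := by
    intro r
    induction r using Nat.strong_induction_on with
    | _ r ih =>
      intro hr
      ext b
      have hsource : κ (⟨r, hr⟩, b) = S.choose r (E.hist S ω r) b := by
        rw [← congrFun h, InfoStrategy.chosen, ← E.hist_castLE S ω hr.le]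
        congr 2
        ext i : 1
        exact (ih i i.isLt _).symm
      rw [hist_apply, ← hsource]
      rfl
  ext r : 1
  exact happly r r.isLt

lemma chosen_hist_eq_iff {ω : Sample K} {t : ℕ} {κ : Fin t × Fin B → Fin K} :
    S.chosen (E.hist S ω t) = κ ↔ S.chosen (E.histAlong κ ω) = κ := by
  constructor
  · rintro rfl
    rw [histAlong_chosen_hist]
  · intro h
    rw [E.hist_eq_histAlong h, h]

variable (S)

@[fun_prop]
lemma measurable_hist (t : ℕ) : Measurable fun ω => E.hist S ω t := by
  have hsum : (fun ω => E.hist S ω t) = fun ω => ∑ κ : Fin t × Fin B → Fin K,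
      if S.chosen (E.histAlong κ ω) = κ then E.histAlong κ ω else 0 := by
    ext ω : 1
    simp_rw [← chosen_hist_eq_iff, Finset.sum_ite_eq, Finset.mem_univ, if_true,
      histAlong_chosen_hist]
  rw [hsum]
  refine Finset.measurable_fun_sum _ fun κ _ => Measurable.ite ?_ (by fun_prop) measurable_const
  exact ((S.measurable_chosen t).comp (E.measurable_histAlong κ)) (measurableSet_singleton κ)

/-- The posterior mean of the payoff-relevant state after a history. -/
def histMean {t : ℕ} (h : History B t) : ℝ := E.postMean (S.chosen h) (Function.uncurry h)

/-- The posterior variance of the payoff-relevant state after a history. -/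
def histVar {t : ℕ} (h : History B t) : ℝ := E.stateVar (S.division h)

/-- The posterior variance in the next period, as known after a history. -/
def nextVar {t : ℕ} (h : History B t) : ℝ := E.stateVar (S.division h + tally (S.choose t h))

@[fun_prop]
lemma measurable_histMean (t : ℕ) : Measurable fun h : History B t => E.histMean S h := by
  have hcase : Measurable fun q : (Fin t × Fin B → Fin K) × History B t =>
      E.postMean q.1 (Function.uncurry q.2) :=
    measurable_from_prod_countable_right fun κ =>
      (E.measurable_postMean κ).comp (measurable_pi_iff.2 fun p => by
        unfold Function.uncurry
        fun_prop)
  exact hcase.comp (f := fun h => (S.chosen h, h)) ((S.measurable_chosen t).prodMk measurable_id)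

@[fun_prop]
lemma measurable_histVar (t : ℕ) : Measurable fun h : History B t => E.histVar S h := by
  simp_rw [histVar, ← InfoStrategy.count_chosen]
  exact (measurable_of_countable fun κ => E.stateVar (count κ)).comp (S.measurable_chosen t)

@[fun_prop]
lemma measurable_nextVar (t : ℕ) : Measurable fun h : History B t => E.nextVar S h := by
  have hcase : Measurable fun q : (Fin t × Fin B → Fin K) × (Fin B → Fin K) =>
      E.stateVar (count q.1 + tally q.2) := measurable_of_countable _
  simp_rw [nextVar, ← InfoStrategy.count_chosen]
  exact hcase.comp (f := fun h : History B t => (S.chosen h, S.choose t h))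
    ((S.measurable_chosen t).prodMk (S.measurable_choose t))

lemma histVar_hist_succ (ω : Sample K) (t : ℕ) :
    E.histVar S (E.hist S ω (t + 1)) = E.nextVar S (E.hist S ω t) := by
  rw [histVar, nextVar, ← InfoStrategy.count_chosen, ← InfoStrategy.count_chosen,
    chosen_hist_succ, count_extendChoice]

variable [NeZero K]
variable (hw : ∀ θ : EuclideanSpace ℝ (Fin K), θ 0 = ∑ k, E.transformedState k θ)
include hw

lemma map_hist_state (t : ℕ) : E.P.map (fun ω => (E.hist S ω t, ω.1 0)) =
    condNormal (E.P.map fun ω => E.hist S ω t) (E.histMean S) fun h => E.histVar S h := by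
  simp_rw [histVar, ← InfoStrategy.count_chosen]
  refine map_eq_condNormal_of_cases (C := S.chosen) (v := fun κ => E.stateVar (count κ))
    (Y := E.histAlong) (Z := fun κ => E.resid (slot κ)) (by fun_prop) (by fun_prop)
    (S.measurable_chosen t) (by fun_prop) (by fun_prop) (by fun_prop)
    (fun κ ω => E.chosen_hist_eq_iff) ?_ ?_
    (fun κ => indepFun_histAlong (E.indepFun_resid_obs hw (slot_injective κ)))
    (fun κ => E.map_resid hw (slot_injective κ))
  · rintro _ ω rfl
    exact (E.histAlong_chosen_hist S ω t).symm
  · rintro _ ω rfl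
    simp only [histAlong_chosen_hist, resid, obs_slot_chosen_hist, histMean, slot]
    ring

lemma map_hist_nextMean (t : ℕ) :
    E.P.map (fun ω => (E.hist S ω t, E.histMean S (E.hist S ω (t + 1)))) =
      condNormal (E.P.map fun ω => E.hist S ω t) (E.histMean S)
        (fun h => E.histVar S h - E.nextVar S h) := by
  simp_rw [histVar, nextVar, ← InfoStrategy.count_chosen]
  refine map_eq_condNormal_of_cases (C := fun h => (S.chosen h, S.choose t h))
    (v := fun i => E.stateVar (count i.1) - E.stateVar (count i.1 + tally i.2))
    (Y := fun i => E.histAlong i.1)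
    (Z := fun i => E.revision (slot i.1) (slot (extendChoice i.1 i.2)))
    (by fun_prop) (by fun_prop) ((S.measurable_chosen t).prodMk (S.measurable_choose t))
    (by fun_prop) (by fun_prop) (fun i => by unfold revision; fun_prop) ?_ ?_ ?_
    (fun i => indepFun_histAlong (E.indepFun_revision_obs hw (slot_injective _)
      (slot_injective _) (range_slot_subset_range_slot_extendChoice _ _))) fun i => ?_
  · rintro ⟨κ, c⟩ ω
    simp only [Prod.mk.injEq]
    rw [chosen_hist_eq_iff]
    exact and_congr_right fun h => by rw [E.hist_eq_histAlong h]
  · rintro _ ω rfl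
    exact (E.histAlong_chosen_hist S ω t).symm
  · rintro _ ω rfl
    simp only [histAlong_chosen_hist, revision, obs_slot_chosen_hist, ← chosen_hist_succ, histMean,
      slot]
    ring
  · rw [← count_extendChoice]
    exact E.map_revision hw (slot_injective _) (slot_injective _)
      (range_slot_subset_range_slot_extendChoice _ _)

theorem isGaussianLearning_hist :
    IsGaussianLearning E.P (fun t ω => E.hist S ω t) (fun ω => ω.1 0) (fun _ => E.histMean S)
      (fun _ => E.histVar S) (fun _ => E.nextVar S) where
  measurable_history := E.measurable_hist S
  measurable_state := by fun_prop
  measurable_mean := E.measurable_histMean S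
  measurable_var := E.measurable_histVar S
  measurable_nextVar := E.measurable_nextVar S
  init_history t ω := E.init_hist S ω t
  var_history_succ t ω := E.histVar_hist_succ S ω t
  nextVar_nonneg _ _ := E.stateVar_nonneg _
  nextVar_le_var _ _ := E.stateVar_antitone le_self_add
  map_state := E.map_hist_state S hw
  map_nextMean := E.map_hist_nextMean S hw

end Environment

section Divisions

variable {K B : ℕ}

lemma sum_tally (c : Fin B → Fin K) : ∑ k, tally c k = B := by
  simp only [tally]
  rw [Finset.sum_card_fiberwise_eq_card_filter]
  simp

lemma InfoStrategy.sum_division (S : InfoStrategy K B) {t : ℕ} (h : History B t) :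
    ∑ k, S.division h k = t * B := by
  simp only [InfoStrategy.division, Finset.sum_apply]
  rw [Finset.sum_comm]
  simp [sum_tally]

lemma exists_tally_eq {d : Fin K → ℕ} (hd : ∑ k, d k = B) : ∃ c : Fin B → Fin K, tally c = d := by
  have e : Fin B ≃ (k : Fin K) × Fin (d k) := (Fintype.equivFinOfCardEq (by simpa using hd)).symm
  refine ⟨fun b => (e b).1, ?_⟩
  ext k
  rw [tally, ← Fintype.card_subtype,
    Fintype.card_congr (e.subtypeEquiv (q := fun p => p.1 = k) fun b => Iff.rfl),
    Fintype.card_congr (Equiv.sigmaSubtype k), Fintype.card_fin]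

lemma exists_eq_add_tally {n n' : Fin K → ℕ} {s : ℕ} (hle : n ≤ n') (hn : ∑ k, n k = s)
    (hn' : ∑ k, n' k = s + B) : ∃ c : Fin B → Fin K, n' = n + tally c := by
  obtain ⟨d, rfl⟩ := exists_add_of_le hle
  simp only [Pi.add_apply, Finset.sum_add_distrib, hn, add_right_inj] at hn'
  obtain ⟨c, rfl⟩ := exists_tally_eq hn'
  exact ⟨c, rfl⟩

lemma exists_sum_eq_isMin [NeZero K] (f : (Fin K → ℕ) → ℝ) (t : ℕ) :
    ∃ n : Fin K → ℕ, ∑ k, n k = t ∧ ∀ q : Fin K → ℕ, ∑ k, q k = t → f n ≤ f q := by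
  obtain ⟨n, hn, hmin⟩ := (Finset.piAntidiag (Finset.univ : Finset (Fin K)) t).exists_min_image f
    ⟨Pi.single 0 t, by simp [Finset.mem_piAntidiag]⟩
  simp only [Finset.mem_piAntidiag, Finset.mem_univ, implies_true, and_true] at hn hmin
  exact ⟨n, hn, hmin⟩

/-- The strategy that observes the sources `c t` in period `t`, whatever the history. -/
def fixedStrategy (c : ℕ → Fin B → Fin K) : InfoStrategy K B where
  choose t _ := c t
  measurable_choose _ := measurable_const

lemma division_fixedStrategy {c : ℕ → Fin B → Fin K} {n : ℕ → Fin K → ℕ} (h₀ : n 0 = 0)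
    (hc : ∀ t, n (t + 1) = n t + tally (c t)) {t : ℕ} (h : History B t) :
    (fixedStrategy c).division h = n t := by
  simp only [InfoStrategy.division, fixedStrategy]
  rw [Fin.sum_univ_eq_sum_range fun s => tally (c s)]
  clear h
  induction t with
  | zero => simp [h₀]
  | succ t ih => rw [Finset.sum_range_succ, ih, hc]

end Divisions

namespace Environment

variable {K B : ℕ} [NeZero K] (E : Environment K)

/-- The strategy `S` serves every decision maker at least as well as any other strategy. -/
def Dominates (S : InfoStrategy K B) : Prop :=
  ∀ (D : DecisionProblem.{u}) (S' : InfoStrategy K B) (A' : DecisionStrategy D B),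
    E.FinitePayoff D S' A' → ∃ A : DecisionStrategy D B, E.FinitePayoff D S A ∧
      E.expectedPayoff D S' A' ≤ E.expectedPayoff D S A

variable {E} in
lemma Dominates.myopicIsOptimal {S : InfoStrategy K B} (h : Dominates.{u} E S)
    (hS : E.IsMyopic S) : MyopicIsOptimal.{u} E B := by
  refine ⟨S, hS, fun D => ⟨h D, ?_⟩⟩
  rintro ⟨S', A', hfin, hbest⟩
  obtain ⟨A, hA, hle⟩ := h D S' A' hfin
  exact ⟨A, hA, fun S₁ A₁ h₁ => (hbest S₁ A₁ h₁).trans hle⟩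

variable {E} in
lemma isMyopic_fixedStrategy {c : ℕ → Fin B → Fin K} {n : ℕ → Fin K → ℕ}
    (hn : ∀ t, E.IsOptimalDivision (t * B) (n t)) (h₀ : n 0 = 0)
    (hc : ∀ t, n (t + 1) = n t + tally (c t)) : E.IsMyopic (fixedStrategy c) := by
  intro t h c'
  rw [division_fixedStrategy h₀ hc]
  change E.postVar (n t + tally (c t)) ≤ _
  rw [← hc]
  refine (hn (t + 1)).2 _ ?_
  simp only [Pi.add_apply, Finset.sum_add_distrib, sum_tally, (hn t).1, Nat.succ_mul]

variable (hw : ∀ θ : EuclideanSpace ℝ (Fin K), θ 0 = ∑ k, E.transformedState k θ)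
include hw

lemma abs_sub_le_of_isOptimalDivision {t : ℕ} {n : Fin K → ℕ} (hn : E.IsOptimalDivision t n)
    (ht : 8 * (E.R + 1) * K * √K ≤ t) (i : Fin K) :
    |(n i : ℝ) - t / K| ≤ 4 * (E.R + 1) * √K := by
  have hmin := hn.2
  simp only [E.postVar_eq_stateVar hw, stateVar] at hmin
  simpa only [Fintype.card_fin, R] using abs_sub_div_card_le_of_isMin
    E.transformedCov_posDef.inv hn.1 hmin (by simpa only [Fintype.card_fin, R] using ht) i

lemma exists_monotone_isOptimalDivision (hB : 8 * (E.R + 1) * K * √K ≤ B) :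
    ∃ n : ℕ → Fin K → ℕ, n 0 = 0 ∧ (∀ t, E.IsOptimalDivision (t * B) (n t)) ∧
      ∀ t, n t ≤ n (t + 1) := by
  choose n hn using fun t => exists_sum_eq_isMin E.postVar (t * B)
  have hn₀ : n 0 = 0 := by
    have hsum := (hn 0).1
    rw [zero_mul, Finset.sum_eq_zero_iff] at hsum
    exact funext fun k => hsum k (Finset.mem_univ k)
  refine ⟨n, hn₀, hn, fun t k => ?_⟩
  rcases t.eq_zero_or_pos with rfl | ht
  · rw [hn₀]
    exact Nat.zero_le _
  · have hclose : ∀ t : ℕ, 0 < t →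
        |(n t k : ℝ) - t * B / K| ≤ 4 * (E.R + 1) * √K := fun t ht => by
      have h := E.abs_sub_le_of_isOptimalDivision hw (hn t)
        (hB.trans (by exact_mod_cast Nat.le_mul_of_pos_left B ht)) k
      rwa [Nat.cast_mul] at h
    have hnow := (abs_le.1 (hclose t ht)).2
    have hnext := (abs_le.1 (hclose (t + 1) t.succ_pos)).1
    have hstep : 8 * (E.R + 1) * √K ≤ B / K := by
      rw [le_div_iff₀ (Nat.cast_pos.2 (NeZero.pos K))]
      linarith
    have hcast : (((t + 1 : ℕ) : ℝ) * B) / K = t * B / K + B / K := by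
      push_cast
      ring
    exact_mod_cast (by linarith : (n t k : ℝ) ≤ n (t + 1) k)

lemma isGaussianLearning_hist_fixedStrategy {c : ℕ → Fin B → Fin K} {n : ℕ → Fin K → ℕ}
    (h₀ : n 0 = 0) (hc : ∀ t, n (t + 1) = n t + tally (c t)) :
    IsGaussianLearning E.P (fun t ω => E.hist (fixedStrategy c) ω t) (fun ω => ω.1 0)
      (fun _ => E.histMean (fixedStrategy c)) (fun t _ => E.stateVar (n t))
      fun t _ => E.stateVar (n (t + 1)) := by
  convert E.isGaussianLearning_hist (fixedStrategy c) hw using 3 with t h t h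
  · rw [histVar, division_fixedStrategy h₀ hc]
  · rw [nextVar, division_fixedStrategy h₀ hc, hc, fixedStrategy]

lemma dominates_fixedStrategy {c : ℕ → Fin B → Fin K} {n : ℕ → Fin K → ℕ}
    (hn : ∀ t, E.IsOptimalDivision (t * B) (n t)) (h₀ : n 0 = 0)
    (hc : ∀ t, n (t + 1) = n t + tally (c t)) : Dominates.{u} E (fixedStrategy c) := by
  intro D S A hA
  have hbest : ∀ t q, ∑ k, q k = t * B → E.stateVar (n t) ≤ E.stateVar q := fun t => by
    simpa only [E.postVar_eq_stateVar hw] using (hn t).2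
  have hact : Measurable fun q : ((t : ℕ) → History B t) × ℝ =>
      ((fun t => A.act t (q.1 (t + 1))), q.2) :=
    (measurable_pi_iff.2 fun t => (A.measurable_act t).comp (by fun_prop)).prodMk measurable_snd
  have hmean₀ : E.histMean S Fin.elim0 = E.histMean (fixedStrategy c) Fin.elim0 := by
    rw [histMean, histMean, Subsingleton.elim (S.chosen _) ((fixedStrategy c).chosen Fin.elim0)]
  have hvar₀ : E.histVar S (Fin.elim0 : History B 0) = E.stateVar (n 0) := by
    rw [histVar, h₀]
    rfl
  obtain ⟨G, hG, hint, hle⟩ := (E.isGaussianLearning_hist S hw).exists_integral_le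
    (E.isGaussianLearning_hist_fixedStrategy hw h₀ hc) hmean₀ hvar₀
    (fun t h => hbest t _ (S.sum_division h))
    (fun t h => hbest (t + 1) _ (by
      simp only [Pi.add_apply, Finset.sum_add_distrib, sum_tally, S.sum_division, Nat.succ_mul]))
    (D.measurable_U.comp hact) hA
  exact ⟨⟨fun t h => A.act t (G (t + 1) h), fun t => (A.measurable_act t).comp (hG (t + 1))⟩,
    hint, hle⟩

theorem myopicIsOptimal (hB : 8 * (E.R + 1) * K * √K ≤ B) : MyopicIsOptimal.{u} E B := by
  obtain ⟨n, h₀, hn, hmono⟩ := E.exists_monotone_isOptimalDivision hw hB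
  choose c hc using fun t => exists_eq_add_tally (hmono t) (hn t).1
    ((hn (t + 1)).1.trans (Nat.succ_mul t B))
  exact (E.dominates_fixedStrategy hw hn h₀ hc).myopicIsOptimal (isMyopic_fixedStrategy hn h₀ hc)

end Environment

end Acquisition

end

theorem proposition1 {K : ℕ} [NeZero K] (E : Acquisition.Environment K)
    (hw : ∀ θ : EuclideanSpace ℝ (Fin K), θ 0 = ∑ k, E.transformedState k θ) :
    (∀ B : ℕ, 8 * (E.R + 1) * (K : ℝ) ^ (1.5 : ℝ) ≤ (B : ℝ) →
      Acquisition.Environment.MyopicIsOptimal.{u} E B) ∧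
    (∀ (t : ℕ) (n : Fin K → ℕ), E.IsOptimalDivision t n →
      8 * (E.R + 1) * (K : ℝ) * √(K : ℝ) ≤ (t : ℝ) →
      ∀ i, |(n i : ℝ) - (t : ℝ) / (K : ℝ)| ≤ 4 * (E.R + 1) * √(K : ℝ)) := by
  refine ⟨fun B hB => E.myopicIsOptimal hw ?_,
    fun t n hn ht i => E.abs_sub_le_of_isOptimalDivision hw hn ht i⟩
  have hpow : (K : ℝ) ^ (1.5 : ℝ) = K * √K := by
    rw [Real.sqrt_eq_rpow, show (1.5 : ℝ) = 1 + 1 / 2 by norm_num,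
      Real.rpow_add (Nat.cast_pos.2 (NeZero.pos K)), Real.rpow_one]
  rwa [hpow, ← mul_assoc] at hB
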